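/- **Notation.** Let $\mathcal S^N_{+}$ and $\mathcal S^N_{++}$ be the sets of real symmetric $N\times N$ matrices that are positive semidefinite, respectively positive definite, and let $\lambda$ be Lebesgue measure on $\mathbb R^N$ (for $N=0$, the unit point mass on the one-point space). For a Borel probability measure $\mu$ on $\mathbb R^N$ with finite second moments put $H(\mu)=-\int\log\frac{d\mu}{d\lambda}\,d\mu$ if $\mu\ll\lambda$, and $H(\mu)=-\infty$ otherwise. For $U:\mathbb R^N\to\mathbb R$ continuous and bounded below and $G\in\mathcal S^N_{++}$ let $$\mathcal F_N[G,U]=\sup\Big\{H(\mu)-\int U\,d\mu\;:\;\mu\text{ a Borel probability measure with finite second moments},\ \int xx^{T}\,d\mu=G\Big\},$$ and define the Luttinger–Ward functional $$\Phi_N[G,U]=2\mathcal F_N[G,U]-\mathrm{Tr}[\log G]-N\log(2\pi e).$$ In dimension $0$ this reads $\Phi_0[U]=-2\,U(0)$. The function $U$ has *strong growth* if for every $\alpha\in\mathbb R$ there is $b\in\mathbb R$ with $U(x)+b\ge\alpha\|x\|^2$ for all $x\in\mathbb R^N$. **Theorem (continuous extension).** Let $U:\mathbb R^N\to\mathbb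 R$ be continuous with strong growth. Then $\Phi_N[\,\cdot\,,U]$ is finite on $\mathcal S^N_{++}$ and has a unique extension to a continuous function $\mathcal S^N_{+}\to\mathbb R$, again denoted $\Phi_N[\,\cdot\,,U]$. The extension has the following values. 1. Let $K\subseteq\mathbb R^N$ be a subspace, $v_1,\dots,v_p$ any orthonormal basis of $K^\perp$, and $V_p=[v_1,\dots,v_p]$, regarded both as an $N\times p$ matrix and as a linear map $\mathbb R^p\to\mathbb R^N$. Then for every $G\in\mathcal S^N_{+}$ with $\ker G=K$, $$\Phi_N[G,U]=\Phi_p\big[V_p^{*}GV_p,\;U\circ V_p\big].$$ 2. For every $0\le p\le N$ and every $G\in\mathcal S^p_{++}$, $$\Phi_N\left[\begin{pmatrix}G&0\\0&0\end{pmatrix},U\right]=\Phi_p\big[G,U(\,\cdot\,,0)\big].$$ In particular (the case $p=0$), $\Phi_N[0,U]=-2\,U(0)$. -/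

import Mathlib

namespace LuttingerWard

open MeasureTheory

noncomputable section

/-- The state space `ℝᴺ`, with the Euclidean norm and Lebesgue measure `volume`. -/
abbrev Space (N : ℕ) : Type := EuclideanSpace ℝ (Fin N)

/-- Strong growth condition: for every `α` there is `b` with `U(x) + b ≥ α‖x‖²` for all `x`. -/
def StrongGrowth {N : ℕ} (U : Space N → ℝ) : Prop :=
  ∀ α : ℝ, ∃ b : ℝ, ∀ x : Space N, α * ‖x‖ ^ 2 ≤ U x + b

/-- The extended-real-valued Lebesgue integral `∫ f⁺ dμ - ∫ f⁻ dμ` of a measurable real function.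
It is the usual one whenever at least one of the two parts has a finite integral. -/
def extIntegral {X : Type*} [MeasurableSpace X] (f : X → ℝ) (μ : Measure X) : EReal :=
  ((∫⁻ x, ENNReal.ofReal (f x) ∂μ : ENNReal) : EReal)
    - ((∫⁻ x, ENNReal.ofReal (-f x) ∂μ : ENNReal) : EReal)

open Classical in
/-- Differential entropy: `-∫ log (dμ/dλ) dμ` if `μ ≪ λ`, and `-∞` otherwise
(`λ` is Lebesgue measure and `llr μ λ = log (dμ/dλ)`). -/
def entropy {N : ℕ} (μ : Measure (Space N)) : EReal :=
  if μ ≪ volume then -extIntegral (llr μ volume) μ else ⊥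

/-- The probability measures on `ℝᴺ` with finite second moments whose second-moment matrix
`∫ x xᵀ dμ` is `G`. -/
def momentFiber {N : ℕ} (G : Matrix (Fin N) (Fin N) ℝ) : Set (Measure (Space N)) :=
  {μ | IsProbabilityMeasure μ ∧ MemLp (fun x : Space N => x) 2 μ ∧
    ∀ i j, ∫ x : Space N, x i * x j ∂μ = G i j}

/-- `F_N[G, U] = sup { H(μ) - ∫ U dμ : ∫ x xᵀ dμ = G }`, with value `-∞` for the empty supremum. -/
def dualFreeEnergy {N : ℕ} (G : Matrix (Fin N) (Fin N) ℝ) (U : Space N → ℝ) : EReal :=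
  ⨆ μ ∈ momentFiber G, (entropy μ - extIntegral U μ)

/-- The Luttinger-Ward functional `Φ_N[G, U] = 2 F_N[G, U] - Tr log G - N log (2πe)`
(meaningful for positive definite `G`; `log G` is the matrix logarithm). -/
def lw {N : ℕ} (G : Matrix (Fin N) (Fin N) ℝ) (U : Space N → ℝ) : EReal :=
  2 * dualFreeEnergy G U
    - (((cfc Real.log G).trace + N * Real.log (2 * Real.pi * Real.exp 1) : ℝ) : EReal)

/-- `Ψ` is a (finite) continuous extension of `Φ_N[·, U]` from the positive definite matrices to
all positive semidefinite matrices. -/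
def IsContinuousExtension {N : ℕ} (U : Space N → ℝ)
    (Ψ : {G : Matrix (Fin N) (Fin N) ℝ // G.PosSemidef} → ℝ) : Prop :=
  Continuous Ψ ∧
    ∀ (G : Matrix (Fin N) (Fin N) ℝ) (hG : G.PosDef), (Ψ ⟨G, hG.posSemidef⟩ : EReal) = lw G U

/-- The matrix `V = [v₁, …, v_p]` whose columns are the given orthonormal basis of `Kᗮ`. -/
def basisMatrix {N p : ℕ} {K : Submodule ℝ (Space N)} (v : OrthonormalBasis (Fin p) ℝ Kᗮ) :
    Matrix (Fin N) (Fin p) ℝ :=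
  Matrix.of fun i k => (v k : Space N) i

/-- The block matrix `diag(G, 0)` of size `N × N`, where `G` is `p × p` (for `p ≤ N`). -/
def padMatrix (N : ℕ) {p : ℕ} (G : Matrix (Fin p) (Fin p) ℝ) : Matrix (Fin N) (Fin N) ℝ :=
  Matrix.of fun i j =>
    if h : (i : ℕ) < p ∧ (j : ℕ) < p then G ⟨i, h.1⟩ ⟨j, h.2⟩ else 0

/-- The vector `(x, 0) ∈ ℝᴺ`, where `x ∈ ℝᵖ` (for `p ≤ N`). -/
def padVector (N : ℕ) {p : ℕ} (x : Space p) : Space N :=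
  WithLp.toLp 2 fun i => if h : (i : ℕ) < p then x ⟨i, h⟩ else 0

/-- `diag(G, 0)` is positive semidefinite when `G` is. -/
theorem padMatrix_posSemidef {N p : ℕ} {G : Matrix (Fin p) (Fin p) ℝ}
    (hG : G.PosSemidef) : (padMatrix N G).PosSemidef := by
  let B : Matrix (Fin p) (Fin N) ℝ := Matrix.of fun a i => if (a : ℕ) = (i : ℕ) then 1 else 0
  have key : padMatrix N G = B.conjTranspose * G * B := by
    have hs : ∀ (f : Fin p → ℝ) (j : Fin N),
        (∑ a : Fin p, if (a : ℕ) = (j : ℕ) then f a else 0) = if h : (j : ℕ) < p then f ⟨j, h⟩ else 0 := by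
      intro f j
      split_ifs with h
      · rw [Finset.sum_eq_single ⟨j, h⟩]
        · simp
        · intro b _ hb
          rw [if_neg]
          intro hc
          exact hb (Fin.ext hc)
        · simp
      · apply Finset.sum_eq_zero
        intro a _
        rw [if_neg]
        have := a.2
        omega
    ext i j
    simp only [Matrix.mul_apply, Matrix.conjTranspose_apply, padMatrix, Matrix.of_apply, B,
      star_trivial, ite_mul, mul_ite, one_mul, mul_one, zero_mul, mul_zero, hs]
    by_cases hi : (i : ℕ) < p <;> by_cases hj : (j : ℕ) < p <;> simp [hi, hj]
  rw [key]
  exact hG.conjTranspose_mul_mul_same B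

end

end LuttingerWard

namespace LuttingerWard

open MeasureTheory Filter Topology

noncomputable section

/-! The singularity of `Φ` at degenerate `G` disappears after rescaling and dualising. For positive
definite `G` put `S = √G` and `x = S y`. The second-moment constraint becomes isotropy, the change
of volume contributes `log det S` to the free energy, and `Tr log G = 2 log det S` cancels it. With
a Lagrange multiplier `B` for the constraint, what remains is `2 log min_B Z_S(B) - N log (2πe)`,
where `Z_S(B) = ∫ exp(-U(S y) - y·B y + tr B) dy` and `B` runs over symmetric matrices. The factor
`exp (tr B)` makes criticality of `Z_S` say that the normalised Gibbs measure has second-moment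
matrix `1`. The Gibbs inequality identifies this measure, transported by `S`, as the maximiser
(`lw_eq_of_isotropic`); existence of a minimiser is `exists_isotropic`.

The dual expression makes sense for every positive semidefinite `G` and is taken as the extension
`lwExt`. If `S = V S' Vᵀ` with `V` a `p`-column isometry, then `U(S y)` ignores the directions
orthogonal to the range of `V`. The optimal multiplier is a `p`-dimensional one on the range and
`1/2` on the complement, where the weight is a standard Gaussian. It contributes the factor
`(2πe)^((N-p)/2)`, which turns the normalisation `N log (2πe)` into `p log (2πe)` and gives the
values on all strata (`Isotropic.lift`).

For continuity, `B ↦ Z_T(B)` is convex with a strict minimum. Strong growth makes `Z` jointly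
continuous near the minimising pair, even at singular `T`, and convexity keeps the minimisation
local (`Isotropic.continuousAt_minPartitionFn`). Continuity of the square root then finishes the
argument. Uniqueness is density of the positive definite matrices. -/

/-! ### Extended-valued integrals -/

theorem extIntegral_eq_coe_integral {X : Type*} [MeasurableSpace X] {μ : Measure X} {f : X → ℝ}
    (hf : Integrable f μ) : extIntegral f μ = ((∫ x, f x ∂μ : ℝ) : EReal) := by
  have h1 : ∫⁻ x, ENNReal.ofReal (f x) ∂μ ≠ ⊤ := hf.lintegral_lt_top.ne
  have h2 : ∫⁻ x, ENNReal.ofReal (-f x) ∂μ ≠ ⊤ := hf.neg.lintegral_lt_top.ne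
  rw [integral_eq_lintegral_pos_part_sub_lintegral_neg_part hf, extIntegral, EReal.coe_sub,
    EReal.coe_ennreal_toReal h1, EReal.coe_ennreal_toReal h2]

/-- An integrable minorant suffices, so the entropy can be bounded without knowing that `llr` is
integrable. -/
theorem coe_integral_le_extIntegral {X : Type*} [MeasurableSpace X] {μ : Measure X} {f r : X → ℝ}
    (hr : Integrable r μ) (h : r ≤ᵐ[μ] f) : ((∫ x, r x ∂μ : ℝ) : EReal) ≤ extIntegral f μ := by
  rw [← extIntegral_eq_coe_integral hr]
  refine EReal.sub_le_sub ?_ ?_ <;> refine EReal.coe_ennreal_le_coe_ennreal_iff.2 ?_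
  · exact lintegral_mono_ae (h.mono fun x hx => ENNReal.ofReal_le_ofReal hx)
  · exact lintegral_mono_ae (h.mono fun x hx => ENNReal.ofReal_le_ofReal (neg_le_neg hx))

theorem integrable_or_extIntegral_eq_top {X : Type*} [MeasurableSpace X] {μ : Measure X}
    [IsFiniteMeasure μ] {f : X → ℝ} (hf : AEStronglyMeasurable f μ) {b : ℝ} (hb : ∀ x, b ≤ f x) :
    Integrable f μ ∨ extIntegral f μ = ⊤ := by
  have h2 : ∫⁻ x, ENNReal.ofReal (-f x) ∂μ ≠ ⊤ := by
    refine ((lintegral_mono (g := fun _ => ENNReal.ofReal (-b)) fun x =>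
      ENNReal.ofReal_le_ofReal (neg_le_neg (hb x))).trans_lt ?_).ne
    rw [lintegral_const]
    exact ENNReal.mul_lt_top ENNReal.ofReal_lt_top (measure_lt_top _ _)
  by_cases h1 : ∫⁻ x, ENNReal.ofReal (f x) ∂μ = ⊤
  · right
    rw [extIntegral, h1, ← ENNReal.coe_toNNReal h2]
    exact EReal.top_sub_coe _
  · left
    refine ⟨hf, ?_⟩
    rw [hasFiniteIntegral_iff_norm]
    refine (lintegral_mono (g := fun x => ENNReal.ofReal (f x) + ENNReal.ofReal (-f x))
      fun x => ?_).trans_lt ?_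
    · rcases le_total 0 (f x) with h | h
      · simp [abs_of_nonneg h]
      · simp [abs_of_nonpos h]
    · rw [lintegral_add_left' hf.aemeasurable.ennreal_ofReal]
      exact ENNReal.add_lt_top.2 ⟨lt_top_iff_ne_top.2 h1, lt_top_iff_ne_top.2 h2⟩

/-! ### Quadratic forms and second moments -/

/-- The quadratic form `y ↦ y ⬝ B y`. -/
def quad {n : ℕ} (B : Matrix (Fin n) (Fin n) ℝ) (y : Space n) : ℝ := y.ofLp ⬝ᵥ B.mulVec y.ofLp

theorem quad_eq_sum {n : ℕ} (B : Matrix (Fin n) (Fin n) ℝ) (y : Space n) :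
    quad B y = ∑ i, ∑ j, B i j * (y i * y j) := by
  simp only [quad, dotProduct, Matrix.mulVec, Finset.mul_sum]
  exact Finset.sum_congr rfl fun i _ => Finset.sum_congr rfl fun j _ => by ring

@[fun_prop]
theorem continuous_quad {n : ℕ} (B : Matrix (Fin n) (Fin n) ℝ) : Continuous (quad B) := by
  simp only [funext (quad_eq_sum B)]
  fun_prop

theorem abs_coord_mul_le {n : ℕ} (y : Space n) (i j : Fin n) : |y i * y j| ≤ ‖y‖ ^ 2 := by
  rw [abs_mul, sq]
  exact mul_le_mul (PiLp.norm_apply_le y i) (PiLp.norm_apply_le y j) (abs_nonneg _) (norm_nonneg _)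

theorem integrable_coord_mul {n : ℕ} {μ : Measure (Space n)}
    (h : Integrable (fun x : Space n => ‖x‖ ^ 2) μ) (i j : Fin n) :
    Integrable (fun x : Space n => x i * x j) μ :=
  h.mono' (by fun_prop) (Filter.Eventually.of_forall fun y => abs_coord_mul_le y i j)

theorem integrable_quad {n : ℕ} {μ : Measure (Space n)}
    (h : Integrable (fun x : Space n => ‖x‖ ^ 2) μ) (B : Matrix (Fin n) (Fin n) ℝ) :
    Integrable (quad B) μ := by
  simp only [funext (quad_eq_sum B)]
  exact integrable_finsetSum _ fun i _ => integrable_finsetSum _ fun j _ =>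
    (integrable_coord_mul h i j).const_mul _

theorem integral_quad {n : ℕ} {μ : Measure (Space n)}
    (h : Integrable (fun x : Space n => ‖x‖ ^ 2) μ) (B : Matrix (Fin n) (Fin n) ℝ) :
    ∫ x, quad B x ∂μ = ∑ i, ∑ j, B i j * ∫ x, x i * x j ∂μ := by
  simp only [quad_eq_sum]
  refine (integral_finsetSum _ fun i _ => integrable_finsetSum _ fun j _ =>
    (integrable_coord_mul h i j).const_mul _).trans (Finset.sum_congr rfl fun i _ => ?_)
  exact (integral_finsetSum _ fun j _ => (integrable_coord_mul h i j).const_mul _).trans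
    (Finset.sum_congr rfl fun j _ => integral_const_mul _ _)

theorem integrable_norm_sq_of_mem_momentFiber {n : ℕ} {G : Matrix (Fin n) (Fin n) ℝ}
    {μ : Measure (Space n)} (hμ : μ ∈ momentFiber G) :
    Integrable (fun x : Space n => ‖x‖ ^ 2) μ :=
  MemLp.integrable_norm_pow (p := 2) hμ.2.1 two_ne_zero

theorem integral_quad_of_mem_momentFiber {n : ℕ} {G : Matrix (Fin n) (Fin n) ℝ}
    {μ : Measure (Space n)} (hμ : μ ∈ momentFiber G) (B : Matrix (Fin n) (Fin n) ℝ) :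
    ∫ x, quad B x ∂μ = ∑ i, ∑ j, B i j * G i j := by
  rw [integral_quad (integrable_norm_sq_of_mem_momentFiber hμ)]
  simp only [hμ.2.2]

/-! ### The Gibbs variational principle -/

/-- Gibbs' variational inequality under a second-moment constraint. -/
theorem entropy_sub_extIntegral_le {n : ℕ} {G : Matrix (Fin n) (Fin n) ℝ} {U : Space n → ℝ}
    (hU : Continuous U) {b : ℝ} (hb : ∀ x, b ≤ U x) (C : Matrix (Fin n) (Fin n) ℝ) (c : ℝ)
    (hZ : ∫⁻ x, ENNReal.ofReal (Real.exp (-(U x + quad C x + c))) ≤ 1)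
    {μ : Measure (Space n)} (hμ : μ ∈ momentFiber G) :
    entropy μ - extIntegral U μ ≤ ((c + ∑ i, ∑ j, C i j * G i j : ℝ) : EReal) := by
  have := hμ.1
  by_cases hac : μ ≪ volume
  swap
  · simp [entropy, hac]
  rcases integrable_or_extIntegral_eq_top (μ := μ) hU.aestronglyMeasurable hb with hUi | hUi
  swap
  · simp [hUi]
  set g : Space n → ℝ := fun x => Real.exp (-(U x + quad C x + c)) with hg
  have hgc : Continuous g := by fun_prop
  set f : Space n → ℝ := fun x => (μ.rnDeriv volume x).toReal with hf
  have hfpos : ∀ᵐ x ∂μ, 0 < f x := by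
    filter_upwards [Measure.rnDeriv_pos hac, hac.ae_le (Measure.rnDeriv_ne_top μ volume)]
      with x h1 h2 using ENNReal.toReal_pos h1.ne' h2
  have hfm : Measurable f := (Measure.measurable_rnDeriv μ volume).ennreal_toReal
  -- Against `μ = f dλ` the quotient `g / f` integrates to the integral of `g` over `{f > 0}` only,
  -- hence an inequality.
  have hle : ∫⁻ x, ENNReal.ofReal (g x / f x) ∂μ ≤ 1 := by
    rw [← lintegral_rnDeriv_mul hac (by fun_prop)]
    refine (lintegral_mono_ae ?_).trans hZ
    filter_upwards [Measure.rnDeriv_ne_top μ volume] with x hx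
    rcases eq_or_ne (μ.rnDeriv volume x) 0 with h0 | h0
    · simp [h0]
    · have hp : 0 < f x := ENNReal.toReal_pos h0 hx
      rw [ENNReal.ofReal_div_of_pos hp, hf, ENNReal.ofReal_toReal hx,
        ENNReal.mul_div_cancel h0 hx]
  have hgf : Integrable (fun x => g x / f x) μ := by
    refine ⟨(hgc.measurable.div hfm).aestronglyMeasurable, ?_⟩
    rw [hasFiniteIntegral_iff_ofReal
      (Filter.Eventually.of_forall fun x => div_nonneg (Real.exp_nonneg _) ENNReal.toReal_nonneg)]
    exact hle.trans_lt ENNReal.one_lt_top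
  have hint : ∫ x, g x / f x ∂μ ≤ 1 := by
    rw [integral_eq_lintegral_of_nonneg_ae
      (Filter.Eventually.of_forall fun x => div_nonneg (Real.exp_nonneg _) ENNReal.toReal_nonneg)
      hgf.1]
    exact ENNReal.toReal_le_of_le_ofReal zero_le_one (by rwa [ENNReal.ofReal_one])
  have hq := integrable_quad (integrable_norm_sq_of_mem_momentFiber hμ) C
  have hUq : Integrable (fun x => U x + quad C x + c) μ := (hUi.add hq).add (integrable_const c)
  have h1 : Integrable (fun x => 1 - g x / f x) μ := (integrable_const 1).sub hgf
  have hr : Integrable (fun x => (1 - g x / f x) - (U x + quad C x + c)) μ := h1.sub hUq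
  -- This is `log t ≤ t - 1` at `t = g / f`; the left side is integrable and its `g / f` part costs
  -- nothing after integration.
  have hmain : (fun x => (1 - g x / f x) - (U x + quad C x + c)) ≤ᵐ[μ] llr μ volume := by
    filter_upwards [hfpos] with x hx
    have h2 := Real.log_le_sub_one_of_pos (div_pos (Real.exp_pos (-(U x + quad C x + c))) hx)
    rw [Real.log_div (Real.exp_pos _).ne' hx.ne', Real.log_exp] at h2
    change _ ≤ Real.log (f x)
    simp only [hg]
    linarith
  have key := coe_integral_le_extIntegral hr hmain
  rw [integral_sub h1 hUq, integral_sub (integrable_const 1) hgf,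
    integral_add (f := fun x => U x + quad C x) (hUi.add hq) (integrable_const c),
    integral_add hUi hq, integral_quad_of_mem_momentFiber hμ] at key
  simp only [integral_const, probReal_univ, smul_eq_mul, mul_one, one_mul] at key
  rw [entropy, if_pos hac, extIntegral_eq_coe_integral hUi]
  have key2 := EReal.neg_le_neg_iff.2 key
  refine (EReal.sub_le_sub key2 le_rfl).trans ?_
  rw [← EReal.coe_neg, ← EReal.coe_sub]
  refine EReal.coe_le_coe_iff.2 ?_
  linarith

/-- If the Gibbs measure with density `exp(-(U + quad C + c))` has second-moment matrix `G`, then it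
maximizes the free energy. -/
theorem dualFreeEnergy_eq_of_gibbs {n : ℕ} {G : Matrix (Fin n) (Fin n) ℝ} {U : Space n → ℝ}
    (hU : Continuous U) {b : ℝ} (hb : ∀ x, b ≤ U x) (C : Matrix (Fin n) (Fin n) ℝ) (c : ℝ)
    (hint : Integrable fun x => Real.exp (-(U x + quad C x + c)))
    (hZ : ∫ x, Real.exp (-(U x + quad C x + c)) = 1)
    (hUint : Integrable fun x => Real.exp (-(U x + quad C x + c)) * U x)
    (hsq : Integrable fun x : Space n => Real.exp (-(U x + quad C x + c)) * ‖x‖ ^ 2)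
    (hG : ∀ i j, ∫ x : Space n, Real.exp (-(U x + quad C x + c)) * (x i * x j) = G i j) :
    dualFreeEnergy G U = ((c + ∑ i, ∑ j, C i j * G i j : ℝ) : EReal) := by
  set g : Space n → ℝ := fun x => Real.exp (-(U x + quad C x + c)) with hg
  have hgc : Continuous g := by fun_prop
  have hZ' : ∫⁻ x, ENNReal.ofReal (g x) = 1 := by
    rw [← ofReal_integral_eq_lintegral_ofReal hint
      (Filter.Eventually.of_forall fun x => Real.exp_nonneg _), hZ, ENNReal.ofReal_one]
  refine le_antisymm (iSup₂_le fun μ hμ => entropy_sub_extIntegral_le hU hb C c hZ'.le hμ) ?_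
  set μ : Measure (Space n) := volume.withDensity fun x => ENNReal.ofReal (g x) with hμdef
  have hdm : Measurable fun x => ENNReal.ofReal (g x) := by fun_prop
  have hdt : ∀ᵐ x : Space n, ENNReal.ofReal (g x) < ⊤ :=
    Filter.Eventually.of_forall fun x => ENNReal.ofReal_lt_top
  have hiff : ∀ φ : Space n → ℝ, Integrable φ μ ↔ Integrable fun x => g x * φ x := fun φ => by
    rw [hμdef, integrable_withDensity_iff_integrable_smul' hdm hdt]
    simp [hg, ENNReal.toReal_ofReal (Real.exp_nonneg _)]
  have heq : ∀ φ : Space n → ℝ, ∫ x, φ x ∂μ = ∫ x, g x * φ x := fun φ => by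
    rw [hμdef, integral_withDensity_eq_integral_toReal_smul hdm hdt]
    simp [hg, ENNReal.toReal_ofReal (Real.exp_nonneg _)]
  have hac : μ ≪ volume := withDensity_absolutelyContinuous _ _
  have hprob : IsProbabilityMeasure μ := ⟨by rw [hμdef]; simpa using hZ'⟩
  have hsqμ : Integrable (fun x : Space n => ‖x‖ ^ 2) μ := (hiff _).2 hsq
  have hmem : μ ∈ momentFiber G := by
    refine ⟨hprob, ?_, fun i j => by rw [heq, hG]⟩
    exact (memLp_two_iff_integrable_sq_norm (by fun_prop)).2 hsqμ
  refine le_trans ?_ (le_iSup₂ (f := fun μ (_ : μ ∈ momentFiber G) =>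
    entropy μ - extIntegral U μ) μ hmem)
  have hUμ : Integrable U μ := (hiff _).2 hUint
  have hq := integrable_quad hsqμ C
  -- For the Gibbs measure itself the log-density is known exactly, so the Gibbs inequality is
  -- attained.
  have hllr : llr μ volume =ᵐ[μ] fun x => -(U x + quad C x + c) := by
    refine hac.ae_le ?_
    filter_upwards [Measure.rnDeriv_withDensity volume hdm] with x hx
    rw [llr, hμdef, hx, ENNReal.toReal_ofReal (Real.exp_nonneg _)]
    exact Real.log_exp _
  have hUq : Integrable (fun x => U x + quad C x + c) μ := (hUμ.add hq).add (integrable_const c)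
  have hli : Integrable (llr μ volume) μ := hUq.neg.congr hllr.symm
  rw [entropy, if_pos hac, extIntegral_eq_coe_integral hli, extIntegral_eq_coe_integral hUμ,
    integral_congr_ae hllr, integral_neg,
    integral_add (f := fun x => U x + quad C x) (hUμ.add hq) (integrable_const c),
    integral_add hUμ hq, integral_quad_of_mem_momentFiber hmem]
  simp only [integral_const, probReal_univ, smul_eq_mul, one_mul]
  rw [← EReal.coe_neg, ← EReal.coe_sub]
  refine EReal.coe_le_coe_iff.2 ?_
  linarith

/-! ### Boltzmann weights and Gaussian integrability -/

/-- The Boltzmann weight `exp(-(u + quad B) + tr B)`. -/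
def weight {n : ℕ} (u : Space n → ℝ) (B : Matrix (Fin n) (Fin n) ℝ) (y : Space n) : ℝ :=
  Real.exp (-(u y + quad B y) + B.trace)

/-- The partition function of `weight u B`. -/
def partitionFn {n : ℕ} (u : Space n → ℝ) (B : Matrix (Fin n) (Fin n) ℝ) : ENNReal :=
  ∫⁻ y, ENNReal.ofReal (weight u B y)

theorem weight_pos {n : ℕ} (u : Space n → ℝ) (B : Matrix (Fin n) (Fin n) ℝ) (y : Space n) :
    0 < weight u B y := Real.exp_pos _

theorem continuous_weight {n : ℕ} {u : Space n → ℝ} (hu : Continuous u)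
    (B : Matrix (Fin n) (Fin n) ℝ) : Continuous (weight u B) := by
  unfold weight
  fun_prop

theorem integrable_weight_iff {n : ℕ} {u : Space n → ℝ} (hu : Continuous u)
    (B : Matrix (Fin n) (Fin n) ℝ) : Integrable (weight u B) ↔ partitionFn u B ≠ ⊤ := by
  rw [← lt_top_iff_ne_top, partitionFn,
    ← hasFiniteIntegral_iff_ofReal (Eventually.of_forall fun y => (weight_pos u B y).le)]
  exact ⟨fun h => h.2, fun h => ⟨(continuous_weight hu B).aestronglyMeasurable, h⟩⟩

theorem partitionFn_eq_ofReal {n : ℕ} {u : Space n → ℝ} {B : Matrix (Fin n) (Fin n) ℝ}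
    (h : Integrable (weight u B)) : partitionFn u B = ENNReal.ofReal (∫ y, weight u B y) :=
  (ofReal_integral_eq_lintegral_ofReal h (Eventually.of_forall fun y => (weight_pos u B y).le)).symm

/-- Half of the Gaussian decay absorbs the polynomial factor. -/
theorem norm_sq_mul_exp_le {V : Type*} [SeminormedAddCommGroup V] {c : ℝ} (hc : 0 < c) (y : V) :
    ‖y‖ ^ 2 * Real.exp (-c * ‖y‖ ^ 2) ≤ 2 / c * Real.exp (-(c / 2) * ‖y‖ ^ 2) := by
  have h1 : c / 2 * ‖y‖ ^ 2 ≤ Real.exp (c / 2 * ‖y‖ ^ 2) := by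
    linarith [Real.add_one_le_exp (c / 2 * ‖y‖ ^ 2)]
  have h2 : Real.exp (-(c / 2) * ‖y‖ ^ 2) =
      Real.exp (c / 2 * ‖y‖ ^ 2) * Real.exp (-c * ‖y‖ ^ 2) := by
    rw [← Real.exp_add]; ring_nf
  have h3 : ‖y‖ ^ 2 ≤ 2 / c * Real.exp (c / 2 * ‖y‖ ^ 2) := by
    rw [div_mul_eq_mul_div, le_div_iff₀ hc]
    linarith
  rw [h2, ← mul_assoc]
  exact mul_le_mul_of_nonneg_right h3 (Real.exp_nonneg _)

section Gaussian

variable {V : Type*} [NormedAddCommGroup V] [InnerProductSpace ℝ V] [FiniteDimensional ℝ V]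
  [MeasurableSpace V] [BorelSpace V]

theorem integrable_exp_neg_mul_norm_sq {c : ℝ} (hc : 0 < c) :
    Integrable fun y : V => Real.exp (-c * ‖y‖ ^ 2) := by
  have h := (GaussianFourier.integrable_cexp_neg_mul_sq_norm_add (V := V) (b := (c : ℂ))
    (by simpa using hc) 0 0).norm
  refine h.congr (Eventually.of_forall fun y => ?_)
  simp only [Complex.norm_exp]
  congr 1
  simp [← Complex.ofReal_pow]

theorem integrable_norm_sq_mul_exp {c : ℝ} (hc : 0 < c) :
    Integrable fun y : V => ‖y‖ ^ 2 * Real.exp (-c * ‖y‖ ^ 2) := by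
  refine ((integrable_exp_neg_mul_norm_sq (half_pos hc)).const_mul (2 / c)).mono'
    (by fun_prop) (Eventually.of_forall fun y => ?_)
  rw [Real.norm_of_nonneg (by positivity)]
  exact norm_sq_mul_exp_le hc y

end Gaussian

theorem norm_toEuclideanLin_sq {m n : ℕ} (T : Matrix (Fin m) (Fin n) ℝ) (y : Space n) :
    ‖Matrix.toEuclideanLin T y‖ ^ 2 = quad (T.transpose * T) y := by
  have h : (Matrix.toEuclideanLin T y).ofLp = T.mulVec y.ofLp := rfl
  rw [EuclideanSpace.real_norm_sq_eq, quad, ← Matrix.mulVec_mulVec, Matrix.dotProduct_mulVec,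
    Matrix.vecMul_transpose, h]
  simp [dotProduct, sq]

theorem quad_add {n : ℕ} (A B : Matrix (Fin n) (Fin n) ℝ) (y : Space n) :
    quad (A + B) y = quad A y + quad B y := by
  simp [quad, Matrix.add_mulVec]

theorem quad_smul {n : ℕ} (a : ℝ) (B : Matrix (Fin n) (Fin n) ℝ) (y : Space n) :
    quad (a • B) y = a * quad B y := by
  simp [quad, Matrix.smul_mulVec]

theorem quad_sub {n : ℕ} (A B : Matrix (Fin n) (Fin n) ℝ) (y : Space n) :
    quad (A - B) y = quad A y - quad B y := by
  simp [quad, Matrix.sub_mulVec]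

theorem quad_one {n : ℕ} (y : Space n) : quad 1 y = ‖y‖ ^ 2 := by
  rw [EuclideanSpace.real_norm_sq_eq]
  simp [quad, dotProduct, sq]

theorem abs_quad_le {n : ℕ} (B : Matrix (Fin n) (Fin n) ℝ) (y : Space n) :
    |quad B y| ≤ (∑ i, ∑ j, |B i j|) * ‖y‖ ^ 2 := by
  rw [quad_eq_sum, Finset.sum_mul]
  refine (Finset.abs_sum_le_sum_abs _ _).trans (Finset.sum_le_sum fun i _ => ?_)
  rw [Finset.sum_mul]
  refine (Finset.abs_sum_le_sum_abs _ _).trans (Finset.sum_le_sum fun j _ => ?_)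
  rw [abs_mul]
  exact mul_le_mul_of_nonneg_left (abs_coord_mul_le y i j) (abs_nonneg _)

/-! ### Admissible pairs and domination by Gaussians -/

/-- The quadratic form `quad B` is controlled from below by `‖y‖²`, up to a multiple of `‖T y‖²`. -/
def Admissible {m n : ℕ} (T : Matrix (Fin m) (Fin n) ℝ) (B : Matrix (Fin n) (Fin n) ℝ) : Prop :=
  ∃ α c : ℝ, 0 < c ∧ ∀ y : Space n, c * ‖y‖ ^ 2 ≤ quad (α • (T.transpose * T) + B) y

theorem admissible_one {n : ℕ} (B : Matrix (Fin n) (Fin n) ℝ) : Admissible (1 : Matrix (Fin n) (Fin n) ℝ) B := by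
  refine ⟨(∑ i, ∑ j, |B i j|) + 1, 1, one_pos, fun y => ?_⟩
  rw [quad_add, quad_smul, Matrix.transpose_one, Matrix.one_mul, quad_one]
  linarith [(abs_le.1 (abs_quad_le B y)).1]

section Admissible

variable {m n : ℕ} {T₀ : Matrix (Fin m) (Fin n) ℝ} {B₀ : Matrix (Fin n) (Fin n) ℝ}

/-- A matrix perturbation whose entries sum to less than `c / 2` in absolute value changes the form
by at most `c / 2 * ‖y‖ ^ 2`. The same `α` and the same lower bound thus serve a whole
neighbourhood, as dominated convergence requires. -/
theorem eventually_quad_ge {α c : ℝ} (hc : 0 < c)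
    (h : ∀ y : Space n, c * ‖y‖ ^ 2 ≤ quad (α • (T₀.transpose * T₀) + B₀) y) :
    ∀ᶠ p : Matrix (Fin m) (Fin n) ℝ × Matrix (Fin n) (Fin n) ℝ in 𝓝 (T₀, B₀),
      ∀ y : Space n, c / 2 * ‖y‖ ^ 2 ≤ quad (α • (p.1.transpose * p.1) + p.2) y := by
  set M : Matrix (Fin m) (Fin n) ℝ × Matrix (Fin n) (Fin n) ℝ → Matrix (Fin n) (Fin n) ℝ :=
    fun p => α • (p.1.transpose * p.1) + p.2 with hM
  have hMc : Continuous M := by fun_prop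
  have hs : Continuous fun p => ∑ i, ∑ j, |(M p - M (T₀, B₀)) i j| := by fun_prop
  have hlt : (∑ i, ∑ j, |(M (T₀, B₀) - M (T₀, B₀)) i j|) < c / 2 := by simpa using hc
  filter_upwards [hs.continuousAt.eventually (gt_mem_nhds hlt)] with p hp y
  have h1 := (abs_le.1 (abs_quad_le (M p - M (T₀, B₀)) y)).1
  rw [quad_sub] at h1
  have h2 := h y
  have h3 := mul_le_mul_of_nonneg_right hp.le (sq_nonneg ‖y‖)
  change _ ≤ quad (M p) y
  change _ ≤ quad (M (T₀, B₀)) y at h2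
  linarith

theorem Admissible.eventually (h : Admissible T₀ B₀) :
    ∀ᶠ p : Matrix (Fin m) (Fin n) ℝ × Matrix (Fin n) (Fin n) ℝ in 𝓝 (T₀, B₀),
      Admissible p.1 p.2 := by
  obtain ⟨α, c, hc, h⟩ := h
  filter_upwards [eventually_quad_ge hc h] with p hp
  exact ⟨α, c / 2, half_pos hc, hp⟩

variable {U : Space m → ℝ}

/-- Strong growth at level `α` trades `U (T y)` for `α ‖T y‖²`, which is what is needed to make the
total quadratic form coercive, even when `T` is singular. -/
theorem weight_comp_le {α b c : ℝ} (hb : ∀ x, α * ‖x‖ ^ 2 ≤ U x + b)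
    (h : ∀ y : Space n, c * ‖y‖ ^ 2 ≤ quad (α • (T₀.transpose * T₀) + B₀) y) (y : Space n) :
    weight (fun y => U (Matrix.toEuclideanLin T₀ y)) B₀ y ≤
      Real.exp (b + B₀.trace) * Real.exp (-c * ‖y‖ ^ 2) := by
  rw [weight, ← Real.exp_add, Real.exp_le_exp]
  have h1 := hb (Matrix.toEuclideanLin T₀ y)
  have h2 := h y
  rw [norm_toEuclideanLin_sq] at h1
  rw [quad_add, quad_smul] at h2
  linarith

theorem continuous_comp_toEuclideanLin (hU : Continuous U) (T : Matrix (Fin m) (Fin n) ℝ) :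
    Continuous fun y => U (Matrix.toEuclideanLin T y) :=
  hU.comp (LinearMap.continuous_of_finiteDimensional _)

theorem Admissible.integrable_weight (h : Admissible T₀ B₀) (hU : Continuous U)
    (hg : StrongGrowth U) :
    Integrable (weight (fun y => U (Matrix.toEuclideanLin T₀ y)) B₀) := by
  obtain ⟨α, c, hc, h⟩ := h
  obtain ⟨b, hb⟩ := hg α
  refine ((integrable_exp_neg_mul_norm_sq hc).const_mul (Real.exp (b + B₀.trace))).mono'
    (continuous_weight (continuous_comp_toEuclideanLin hU T₀) B₀).aestronglyMeasurable
    (Eventually.of_forall fun y => ?_)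
  rw [Real.norm_of_nonneg (weight_pos _ _ _).le]
  exact weight_comp_le hb h y

theorem Admissible.integrable_norm_sq_mul_weight (h : Admissible T₀ B₀) (hU : Continuous U)
    (hg : StrongGrowth U) :
    Integrable fun y => ‖y‖ ^ 2 * weight (fun y => U (Matrix.toEuclideanLin T₀ y)) B₀ y := by
  obtain ⟨α, c, hc, h⟩ := h
  obtain ⟨b, hb⟩ := hg α
  have hw := continuous_weight (continuous_comp_toEuclideanLin hU T₀) B₀
  refine ((integrable_norm_sq_mul_exp hc).const_mul (Real.exp (b + B₀.trace))).mono'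
    (Continuous.aestronglyMeasurable (by fun_prop)) (Eventually.of_forall fun y => ?_)
  rw [Real.norm_of_nonneg (mul_nonneg (sq_nonneg _) (weight_pos _ _ _).le), mul_left_comm]
  exact mul_le_mul_of_nonneg_left (weight_comp_le hb h y) (sq_nonneg _)

theorem Admissible.continuousAt_partitionFn (h : Admissible T₀ B₀) (hU : Continuous U)
    (hg : StrongGrowth U) :
    ContinuousAt (fun p : Matrix (Fin m) (Fin n) ℝ × Matrix (Fin n) (Fin n) ℝ =>
      partitionFn (fun y => U (Matrix.toEuclideanLin p.1 y)) p.2) (T₀, B₀) := by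
  obtain ⟨α, c, hc, h⟩ := h
  obtain ⟨b, hb⟩ := hg α
  have htr : ∀ᶠ p : Matrix (Fin m) (Fin n) ℝ × Matrix (Fin n) (Fin n) ℝ in 𝓝 (T₀, B₀),
      p.2.trace < B₀.trace + 1 := by
    have : Continuous fun p : Matrix (Fin m) (Fin n) ℝ × Matrix (Fin n) (Fin n) ℝ =>
      p.2.trace := by fun_prop
    exact this.continuousAt.eventually (gt_mem_nhds (lt_add_one _))
  have : FirstCountableTopology (Matrix (Fin m) (Fin n) ℝ) :=
    inferInstanceAs (FirstCountableTopology (Fin m → Fin n → ℝ))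
  have : FirstCountableTopology (Matrix (Fin n) (Fin n) ℝ) :=
    inferInstanceAs (FirstCountableTopology (Fin n → Fin n → ℝ))
  refine tendsto_lintegral_filter_of_dominated_convergence
    (fun y => ENNReal.ofReal (Real.exp (b + (B₀.trace + 1)) * Real.exp (-(c / 2) * ‖y‖ ^ 2)))
    (Eventually.of_forall fun p =>
      (continuous_weight (continuous_comp_toEuclideanLin hU p.1) p.2).measurable.ennreal_ofReal)
    ?_ ((integrable_exp_neg_mul_norm_sq (half_pos hc)).const_mul _).lintegral_lt_top.ne
    (Eventually.of_forall fun y => ?_)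
  · filter_upwards [eventually_quad_ge hc h, htr] with p hp htr
    refine Eventually.of_forall fun y => ENNReal.ofReal_le_ofReal ?_
    refine (weight_comp_le hb hp y).trans (mul_le_mul_of_nonneg_right ?_ (Real.exp_nonneg _))
    exact Real.exp_le_exp.2 (by linarith)
  · refine (ENNReal.continuous_ofReal.tendsto _).comp ?_
    have hT : Continuous fun p : Matrix (Fin m) (Fin n) ℝ × Matrix (Fin n) (Fin n) ℝ =>
        Matrix.toEuclideanLin p.1 y := by
      have h1 : Continuous fun p : Matrix (Fin m) (Fin n) ℝ × Matrix (Fin n) (Fin n) ℝ =>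
        p.1.mulVec y.ofLp := by fun_prop
      exact (PiLp.continuous_toLp 2 _).comp h1
    have hq : Continuous fun p : Matrix (Fin m) (Fin n) ℝ × Matrix (Fin n) (Fin n) ℝ =>
        quad p.2 y := by
      unfold quad
      fun_prop
    have : Continuous fun p : Matrix (Fin m) (Fin n) ℝ × Matrix (Fin n) (Fin n) ℝ =>
        weight (fun y => U (Matrix.toEuclideanLin p.1 y)) p.2 y := by
      unfold weight
      fun_prop
    exact this.tendsto _

end Admissible

/-! ### Gibbs measures and isotropy -/

section

open scoped Matrix.Norms.Elementwise

theorem toReal_ofReal_weight {n : ℕ} (u : Space n → ℝ) (B : Matrix (Fin n) (Fin n) ℝ)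
    (y : Space n) : (ENNReal.ofReal (weight u B y)).toReal = weight u B y :=
  ENNReal.toReal_ofReal (weight_pos u B y).le

/-- The (unnormalised) Gibbs measure with density `weight u B`. -/
def gibbs {n : ℕ} (u : Space n → ℝ) (B : Matrix (Fin n) (Fin n) ℝ) : Measure (Space n) :=
  volume.withDensity fun y => ENNReal.ofReal (weight u B y)

section Gibbs

variable {n : ℕ} {u : Space n → ℝ} {B : Matrix (Fin n) (Fin n) ℝ}

theorem integrable_gibbs_iff (hu : Continuous u) (f : Space n → ℝ) :
    Integrable f (gibbs u B) ↔ Integrable fun y => weight u B y * f y := by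
  rw [gibbs, integrable_withDensity_iff_integrable_smul'
    (continuous_weight hu B).measurable.ennreal_ofReal
    (Eventually.of_forall fun _ => ENNReal.ofReal_lt_top)]
  simp only [toReal_ofReal_weight, smul_eq_mul]

theorem integral_gibbs (hu : Continuous u) (f : Space n → ℝ) :
    ∫ y, f y ∂(gibbs u B) = ∫ y, weight u B y * f y := by
  rw [gibbs, integral_withDensity_eq_integral_toReal_smul
    (continuous_weight hu B).measurable.ennreal_ofReal
    (Eventually.of_forall fun _ => ENNReal.ofReal_lt_top)]
  simp only [toReal_ofReal_weight, smul_eq_mul]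

end Gibbs

/-- The Gibbs measure of `u` and `B` has second-moment matrix `1` after normalisation. -/
def Isotropic {n : ℕ} (u : Space n → ℝ) (B : Matrix (Fin n) (Fin n) ℝ) : Prop :=
  Integrable (weight u B) ∧ Integrable (fun y => weight u B y * ‖y‖ ^ 2) ∧
    ∀ a : Space n, ∫ y, weight u B y * inner ℝ a y ^ 2 = ‖a‖ ^ 2 * ∫ y, weight u B y

theorem inner_single_add_single {n : ℕ} (i j : Fin n) (y : Space n) :
    inner ℝ (EuclideanSpace.single i (1 : ℝ) + EuclideanSpace.single j 1) y = y i + y j := by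
  simp [inner_add_left, EuclideanSpace.inner_single_left]

theorem norm_single_add_single_sq {n : ℕ} (i j : Fin n) :
    ‖(EuclideanSpace.single i (1 : ℝ) + EuclideanSpace.single j 1 : Space n)‖ ^ 2 =
      2 + 2 * (1 : Matrix (Fin n) (Fin n) ℝ) i j := by
  rw [← real_inner_self_eq_norm_sq, inner_single_add_single]
  by_cases h : i = j
  · subst h; simp; norm_num
  · simp [h, Ne.symm h]; norm_num

theorem quad_single_add_single {n : ℕ} (D : Matrix (Fin n) (Fin n) ℝ) (i j : Fin n) :
    quad D (WithLp.toLp 2 (Pi.single i 1 + Pi.single j 1)) = D i i + D i j + D j i + D j j := by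
  simp only [quad, Matrix.mulVec_add, dotProduct_add, add_dotProduct, Matrix.mulVec_single_one,
    single_one_dotProduct, Matrix.col_apply]
  ring

theorem eq_zero_of_quad_eq_zero {n : ℕ} {D : Matrix (Fin n) (Fin n) ℝ} (hD : D.IsSymm)
    (h : ∀ y, quad D y = 0) : D = 0 := by
  have hd : ∀ i, D i i = 0 := fun i => by
    have := (quad_single_add_single D i i).symm.trans (h _)
    linarith
  ext i j
  have h1 := (quad_single_add_single D i j).symm.trans (h _)
  have h2 : D j i = D i j := hD.apply i j
  rw [hd, hd, h2] at h1
  simp only [Matrix.zero_apply]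
  linarith

namespace Isotropic

variable {n : ℕ} {u : Space n → ℝ} {B : Matrix (Fin n) (Fin n) ℝ}

theorem integrable_norm_sq (h : Isotropic u B) (hu : Continuous u) :
    Integrable (fun y : Space n => ‖y‖ ^ 2) (gibbs u B) :=
  (integrable_gibbs_iff hu _).2 h.2.1

theorem integral_sq_add (h : Isotropic u B) (hu : Continuous u) (i j : Fin n) :
    ∫ y, (y i + y j) ^ 2 ∂(gibbs u B) =
      (2 + 2 * (1 : Matrix (Fin n) (Fin n) ℝ) i j) * ∫ y, weight u B y := by
  rw [integral_gibbs hu, ← norm_single_add_single_sq, ← h.2.2]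
  simp only [inner_single_add_single]

/-- Polarisation: the diagonal case comes from `i = j`, the mixed moment from the direction `e_i +
e_j`. -/
theorem integral_coord_mul (h : Isotropic u B) (hu : Continuous u) (i j : Fin n) :
    ∫ y, y i * y j ∂(gibbs u B) = (1 : Matrix (Fin n) (Fin n) ℝ) i j * ∫ y, weight u B y := by
  have hI := integrable_coord_mul (h.integrable_norm_sq hu)
  have hii : ∀ i, ∫ y, y i * y i ∂(gibbs u B) = ∫ y, weight u B y := fun i => by
    have h1 := h.integral_sq_add hu i i
    have h2 : ∀ y : Space n, (y i + y i) ^ 2 = 4 * (y i * y i) := fun y => by ring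
    simp only [h2, integral_const_mul, Matrix.one_apply_eq] at h1
    linarith
  have h1 := h.integral_sq_add hu i j
  have h2 : ∀ y : Space n, (y i + y j) ^ 2 = (y i * y i + y j * y j) + 2 * (y i * y j) :=
    fun y => by ring
  simp only [h2] at h1
  rw [integral_add (f := fun y : Space n => y i * y i + y j * y j) ((hI i i).add (hI j j))
    ((hI i j).const_mul 2), integral_add (hI i i) (hI j j), hii, hii, integral_const_mul] at h1
  linarith

theorem integral_quad (h : Isotropic u B) (hu : Continuous u) (D : Matrix (Fin n) (Fin n) ℝ) :
    ∫ y, quad D y ∂(gibbs u B) = D.trace * ∫ y, weight u B y := by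
  rw [LuttingerWard.integral_quad (h.integrable_norm_sq hu)]
  simp only [h.integral_coord_mul hu, ← mul_assoc, ← Finset.sum_mul]
  simp [Matrix.trace, Matrix.one_apply]

theorem integral_weight_pos (h : Isotropic u B) : 0 < ∫ y, weight u B y := by
  refine (integral_pos_iff_support_of_nonneg (fun y => (weight_pos u B y).le) h.1).2 ?_
  rw [show Function.support (weight u B) = Set.univ from
    Set.eq_univ_of_forall fun y => (weight_pos u B y).ne']
  exact (isOpen_univ.measure_pos _ Set.univ_nonempty)

/-- Isotropy is the first-order condition for `B`, and strict convexity of the exponential makes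
such a critical point a strict global minimum among symmetric matrices. -/
theorem partitionFn_lt (h : Isotropic u B) (hu : Continuous u) (hB : B.IsSymm)
    {B' : Matrix (Fin n) (Fin n) ℝ} (hB' : B'.IsSymm) (hne : B' ≠ B) :
    partitionFn u B < partitionFn u B' := by
  by_cases htop : partitionFn u B' = ⊤
  · rw [htop]
    exact lt_top_iff_ne_top.2 ((integrable_weight_iff hu B).1 h.1)
  have hI' := (integrable_weight_iff hu B').2 htop
  set g : Space n → ℝ := fun y => quad (B' - B) y - (B' - B).trace with hg
  have hgc : Continuous g := by fun_prop
  have hw : ∀ y, weight u B' y = weight u B y * Real.exp (-g y) := fun y => by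
    rw [weight, weight, ← Real.exp_add]
    simp only [hg, quad_sub, Matrix.trace_sub]
    ring_nf
  -- The first-order term vanishes: under an isotropic Gibbs measure `quad D` averages to `D.trace`.
  have hwg : ∫ y, weight u B y * g y = 0 := by
    rw [← integral_gibbs hu]
    have hfin : IsFiniteMeasure (gibbs u B) := by
      refine ⟨?_⟩
      rw [gibbs, withDensity_apply _ MeasurableSet.univ, Measure.restrict_univ]
      exact lt_top_iff_ne_top.2 ((integrable_weight_iff hu B).1 h.1)
    rw [integral_sub (integrable_quad (h.integrable_norm_sq hu) _) (integrable_const _),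
      h.integral_quad hu, integral_gibbs hu, integral_mul_const]
    ring
  have hwgi : Integrable fun y => weight u B y * g y := by
    have h1 := (integrable_gibbs_iff hu _).1 (integrable_quad (h.integrable_norm_sq hu) (B' - B))
    refine (h1.sub (h.1.mul_const (B' - B).trace)).congr (Eventually.of_forall fun y => ?_)
    simp only [hg, Pi.sub_apply]
    ring
  -- The integrand is `weight u B * (exp (-g) - 1 + g)`, nonnegative and zero only where `g = 0`.
  have hpos : 0 < ∫ y, (weight u B' y - weight u B y) + weight u B y * g y := by
    have heq : ∀ y, (weight u B' y - weight u B y) + weight u B y * g y =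
        weight u B y * (Real.exp (-g y) - (-g y + 1)) := fun y => by rw [hw]; ring
    refine (integral_pos_iff_support_of_nonneg
      (f := fun y => (weight u B' y - weight u B y) + weight u B y * g y) (fun y => ?_)
      ((hI'.sub h.1).add hwgi)).2 ?_
    · simp only [Pi.zero_apply, heq]
      exact mul_nonneg (weight_pos u B y).le (sub_nonneg.2 (Real.add_one_le_exp _))
    · have hcont : Continuous fun y => (weight u B' y - weight u B y) + weight u B y * g y := by
        have := continuous_weight hu B
        have := continuous_weight hu B'
        fun_prop
      refine hcont.isOpen_support.measure_pos _ ?_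
      by_contra hemp
      rw [Set.not_nonempty_iff_eq_empty, Function.support_eq_empty_iff] at hemp
      have hg0 : ∀ y, g y = 0 := fun y => by
        by_contra hgy
        have h1 := congrFun hemp y
        simp only [heq, Pi.zero_apply] at h1
        have h2 := Real.add_one_lt_exp (neg_ne_zero.2 hgy)
        exact (mul_pos (weight_pos u B y) (sub_pos.2 h2)).ne' h1
      -- Evaluating the identically vanishing `g` at the origin isolates the trace; the quadratic
      -- form then vanishes as well.
      have htr : (B' - B).trace = 0 := by
        have := hg0 0
        simp [hg, quad] at this; rw [Matrix.trace_sub]; linarith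
      refine hne (sub_eq_zero.1 (eq_zero_of_quad_eq_zero (hB'.sub hB) fun y => ?_))
      have := hg0 y
      simp only [hg, htr, sub_zero] at this
      exact this
  rw [integral_add (f := fun y => weight u B' y - weight u B y) (hI'.sub h.1) hwgi,
    integral_sub hI' h.1, hwg] at hpos
  rw [partitionFn_eq_ofReal h.1, partitionFn_eq_ofReal hI',
    ENNReal.ofReal_lt_ofReal_iff_of_nonneg (h.integral_weight_pos).le]
  linarith

theorem partitionFn_le (h : Isotropic u B) (hu : Continuous u) (hB : B.IsSymm)
    {B' : Matrix (Fin n) (Fin n) ℝ} (hB' : B'.IsSymm) :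
    partitionFn u B ≤ partitionFn u B' := by
  rcases eq_or_ne B' B with rfl | hne
  · exact le_rfl
  · exact (h.partitionFn_lt hu hB hB' hne).le

end Isotropic

/-! ### Convexity in the multiplier and continuity of the minimum -/

/-- The exponent of the weight is affine in the multiplier, so the weight is pointwise convex in it.
Values in `ENNReal` let divergent multipliers take part. -/
theorem partitionFn_convexComb_le {n : ℕ} {u : Space n → ℝ} (hu : Continuous u)
    (A B : Matrix (Fin n) (Fin n) ℝ) {s t : ℝ} (hs : 0 ≤ s) (ht : 0 ≤ t) (hst : s + t = 1) :
    partitionFn u (s • A + t • B) ≤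
      ENNReal.ofReal s * partitionFn u A + ENNReal.ofReal t * partitionFn u B := by
  have hA : Measurable fun y => ENNReal.ofReal (weight u A y) :=
    (continuous_weight hu A).measurable.ennreal_ofReal
  have hB : Measurable fun y => ENNReal.ofReal (weight u B y) :=
    (continuous_weight hu B).measurable.ennreal_ofReal
  rw [partitionFn, partitionFn, partitionFn, ← lintegral_const_mul _ hA,
    ← lintegral_const_mul _ hB, ← lintegral_add_left (hA.const_mul _)]
  refine lintegral_mono fun y => ?_
  rw [← ENNReal.ofReal_mul hs, ← ENNReal.ofReal_mul ht, ← ENNReal.ofReal_add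
    (mul_nonneg hs (weight_pos u A y).le) (mul_nonneg ht (weight_pos u B y).le)]
  refine ENNReal.ofReal_le_ofReal ?_
  have h := convexOn_exp.2 (Set.mem_univ (-(u y + quad A y) + A.trace))
    (Set.mem_univ (-(u y + quad B y) + B.trace)) hs ht hst
  refine le_trans (le_of_eq ?_) h
  rw [weight, quad_add, quad_smul, quad_smul, Matrix.trace_add, Matrix.trace_smul,
    Matrix.trace_smul]
  congr 1
  simp only [smul_eq_mul]
  linear_combination (u y) * hst

theorem partitionFn_convexComb_le_max {n : ℕ} {u : Space n → ℝ} (hu : Continuous u)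
    (A B : Matrix (Fin n) (Fin n) ℝ) {s t : ℝ} (hs : 0 ≤ s) (ht : 0 ≤ t) (hst : s + t = 1) :
    partitionFn u (s • A + t • B) ≤ max (partitionFn u A) (partitionFn u B) := by
  refine (partitionFn_convexComb_le hu A B hs ht hst).trans ((add_le_add
    (mul_le_mul_right (le_max_left _ (partitionFn u B)) _)
    (mul_le_mul_right (le_max_right (partitionFn u A) _) _)).trans (le_of_eq ?_))
  rw [← add_mul, ← ENNReal.ofReal_add hs ht, hst, ENNReal.ofReal_one, one_mul]

/-- The minimal partition function over symmetric matrices. -/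
def minPartitionFn {n : ℕ} (u : Space n → ℝ) : ENNReal :=
  ⨅ B : {B : Matrix (Fin n) (Fin n) ℝ // B.IsSymm}, partitionFn u B

theorem Isotropic.minPartitionFn_eq {n : ℕ} {u : Space n → ℝ} {B : Matrix (Fin n) (Fin n) ℝ}
    (h : Isotropic u B) (hu : Continuous u) (hB : B.IsSymm) :
    minPartitionFn u = partitionFn u B :=
  le_antisymm (iInf_le (fun B : {B : Matrix (Fin n) (Fin n) ℝ // B.IsSymm} => partitionFn u B)
    ⟨B, hB⟩) (le_iInf fun B' => h.partitionFn_le hu hB B'.2)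

theorem isClosed_isSymm (n : ℕ) : IsClosed {B : Matrix (Fin n) (Fin n) ℝ | B.IsSymm} :=
  isClosed_eq (by fun_prop) (by fun_prop)

/-- Upper semicontinuity comes from testing with `B₀`. For lower semicontinuity, compactness handles
multipliers in a small ball; beyond it, a strict gap on the sphere propagates outwards by convexity.
-/
theorem Isotropic.continuousAt_minPartitionFn {m n : ℕ} {U : Space m → ℝ} (hU : Continuous U)
    (hg : StrongGrowth U) {T₀ : Matrix (Fin m) (Fin n) ℝ} {B₀ : Matrix (Fin n) (Fin n) ℝ}
    (h : Isotropic (fun y => U (Matrix.toEuclideanLin T₀ y)) B₀) (hB₀ : B₀.IsSymm)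
    (hadm : Admissible T₀ B₀) :
    ContinuousAt (fun T : Matrix (Fin m) (Fin n) ℝ =>
      minPartitionFn fun y => U (Matrix.toEuclideanLin T y)) T₀ := by
  have hc := continuous_comp_toEuclideanLin (n := n) hU
  set F : Matrix (Fin m) (Fin n) ℝ → Matrix (Fin n) (Fin n) ℝ → ENNReal :=
    fun T B => partitionFn (fun y => U (Matrix.toEuclideanLin T y)) B with hF
  have hval := h.minPartitionFn_eq (hc T₀) hB₀
  have hprop : ProperSpace (Matrix (Fin n) (Fin n) ℝ) := FiniteDimensional.proper ℝ _
  obtain ⟨r, hr, hball⟩ : ∃ r > 0, ∀ B ∈ Metric.closedBall B₀ r, Admissible T₀ B := by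
    have h1 : ∀ᶠ B in 𝓝 B₀, Admissible T₀ B :=
      (Continuous.prodMk_right T₀).continuousAt.eventually hadm.eventually
    exact Metric.nhds_basis_closedBall.eventually_iff.1 h1
  have hFc : ∀ B ∈ Metric.closedBall B₀ r,
      ContinuousAt (fun p : Matrix (Fin m) (Fin n) ℝ × Matrix (Fin n) (Fin n) ℝ => F p.1 p.2)
        (T₀, B) := fun B hB => (hball B hB).continuousAt_partitionFn hU hg
  have hB₀mem : B₀ ∈ Metric.closedBall B₀ r := Metric.mem_closedBall_self hr.le
  have hF0 : ContinuousAt (fun T => F T B₀) T₀ :=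
    ContinuousAt.comp (f := fun T => (T, B₀)) (hFc B₀ hB₀mem)
      (Continuous.prodMk_left B₀).continuousAt
  have hFtop : F T₀ B₀ ≠ ⊤ := (integrable_weight_iff (hc T₀) B₀).1 h.1
  rw [ContinuousAt, hval]
  refine tendsto_order.2 ⟨fun a ha => ?_, fun a ha => ?_⟩
  swap
  · filter_upwards [hF0.eventually (gt_mem_nhds ha)] with T hT
    exact (iInf_le (fun B : {B : Matrix (Fin n) (Fin n) ℝ // B.IsSymm} => F T B)
      ⟨B₀, hB₀⟩).trans_lt hT
  obtain ⟨a', haa', ha'⟩ := exists_between ha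
  set K : Set (Matrix (Fin n) (Fin n) ℝ) := {B | B.IsSymm} ∩ Metric.closedBall B₀ r
  set S : Set (Matrix (Fin n) (Fin n) ℝ) := {B | B.IsSymm} ∩ Metric.sphere B₀ r
  have hK : IsCompact K := (isCompact_closedBall B₀ r).inter_left (isClosed_isSymm n)
  have hS : IsCompact S := (isCompact_sphere B₀ r).inter_left (isClosed_isSymm n)
  have hSball : ∀ B ∈ S, B ∈ Metric.closedBall B₀ r := fun B hB =>
    Metric.sphere_subset_closedBall hB.2
  -- The level `c` separates the minimum from the values on the sphere; if there are no symmetric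
  -- matrices on the sphere, `⊤` serves.
  obtain ⟨c, hc0, hcS⟩ : ∃ c, F T₀ B₀ < c ∧ ∀ B ∈ S, c < F T₀ B := by
    rcases S.eq_empty_or_nonempty with hemp | hne
    · exact ⟨⊤, lt_top_iff_ne_top.2 hFtop, by simp [hemp]⟩
    · obtain ⟨B, hB, hmin⟩ := hS.exists_isMinOn hne (f := F T₀) fun B hB =>
        (ContinuousAt.comp (f := fun B => (T₀, B)) (hFc B (hSball B hB))
          (Continuous.prodMk_right T₀).continuousAt).continuousWithinAt
      have hlt : F T₀ B₀ < F T₀ B := h.partitionFn_lt (hc T₀) hB₀ hB.1 fun he => by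
        have := hB.2
        rw [he, Metric.mem_sphere, dist_self] at this
        exact hr.ne this
      obtain ⟨c, h1, h2⟩ := exists_between hlt
      exact ⟨c, h1, fun B' hB' => h2.trans_le (hmin hB')⟩
  have e1 : ∀ᶠ T in 𝓝 T₀, ∀ B ∈ K, a' < F T B :=
    hK.eventually_forall_of_forall_eventually fun B hB =>
      (hFc B hB.2).eventually (lt_mem_nhds (ha'.trans_le (h.partitionFn_le (hc T₀) hB₀ hB.1)))
  have e2 : ∀ᶠ T in 𝓝 T₀, ∀ B ∈ S, c < F T B :=
    hS.eventually_forall_of_forall_eventually fun B hB =>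
      (hFc B (hSball B hB)).eventually (lt_mem_nhds (hcS B hB))
  filter_upwards [e1, e2, hF0.eventually (gt_mem_nhds hc0)] with T h1 h2 h3
  refine haa'.trans_le (le_iInf fun ⟨B, hB⟩ => ?_)
  by_cases hBr : dist B B₀ ≤ r
  · exact (h1 B ⟨hB, hBr⟩).le
  · push Not at hBr
    have hd : 0 < dist B B₀ := hr.trans hBr
    -- The segment from `B₀` to a far `B` crosses the sphere at parameter `t`. The value there
    -- exceeds `c` while the value at `B₀` does not, so quasiconvexity forces the value at `B` above
    -- `c`.
    set t := r / dist B B₀ with ht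
    have ht1 : t < 1 := (div_lt_one hd).2 hBr
    have ht0 : 0 < t := div_pos hr hd
    have hmem : (1 - t) • B₀ + t • B ∈ S := by
      refine ⟨(hB₀.smul _).add (hB.smul _), ?_⟩
      rw [Metric.mem_sphere, dist_eq_norm]
      have : (1 - t) • B₀ + t • B - B₀ = t • (B - B₀) := by
        rw [sub_smul, one_smul, smul_sub]; abel
      rw [this, norm_smul, Real.norm_of_nonneg ht0.le, ← dist_eq_norm, ht]
      field_simp
    have h4 := (h2 _ hmem).trans_le (partitionFn_convexComb_le_max (hc T) B₀ B
      (sub_nonneg.2 ht1.le) ht0.le (sub_add_cancel 1 t))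
    rcases lt_max_iff.1 h4 with h5 | h5
    · exact absurd (h5.trans h3) (lt_irrefl _)
    · exact ((ha'.trans hc0).trans h5).le

end

/-! ### Existence of an isotropic multiplier -/

section

open scoped Matrix.Norms.Elementwise

theorem toEuclideanLin_one_apply {n : ℕ} (y : Space n) :
    Matrix.toEuclideanLin (1 : Matrix (Fin n) (Fin n) ℝ) y = y := by
  change WithLp.toLp 2 (Matrix.mulVec 1 y.ofLp) = y
  rw [Matrix.one_mulVec]

theorem inner_eq_dotProduct {n : ℕ} (a y : Space n) : inner ℝ a y = a.ofLp ⬝ᵥ y.ofLp := by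
  rw [EuclideanSpace.inner_eq_star_dotProduct, star_trivial, dotProduct_comm]

theorem quad_vecMulVec {n : ℕ} (a y : Space n) :
    quad (Matrix.vecMulVec a.ofLp a.ofLp) y = inner ℝ a y ^ 2 := by
  rw [inner_eq_dotProduct, quad, Matrix.vecMulVec_mulVec, dotProduct_smul, dotProduct_comm]
  simp [sq]

theorem trace_vecMulVec_self {n : ℕ} (a : Space n) :
    (Matrix.vecMulVec a.ofLp a.ofLp).trace = ‖a‖ ^ 2 := by
  rw [Matrix.trace_vecMulVec, ← inner_eq_dotProduct, real_inner_self_eq_norm_sq]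

/-- Otherwise the origin gives trace at most zero, while scaling shows that the form is nonnegative.
A positive semidefinite matrix with nonpositive trace is zero. -/
theorem exists_quad_lt_trace {n : ℕ} {D : Matrix (Fin n) (Fin n) ℝ} (hD : D.IsSymm)
    (h0 : D ≠ 0) : ∃ y : Space n, quad D y < D.trace := by
  by_contra! hcon
  have htr : D.trace ≤ 0 := by simpa [quad] using hcon 0
  have hnn : ∀ y : Space n, 0 ≤ quad D y := fun y => by
    by_contra! hy
    obtain ⟨k, hk⟩ := exists_nat_gt (D.trace / quad D y)
    rw [div_lt_iff_of_neg hy] at hk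
    have hk0 : (k : ℝ) * quad D y ≥ k ^ 2 * quad D y := by
      refine mul_le_mul_of_nonpos_right ?_ hy.le
      rcases Nat.eq_zero_or_pos k with rfl | hpos
      · simp
      · have : (1 : ℝ) ≤ k := by exact_mod_cast hpos
        nlinarith
    have h1 := hcon ((k : ℝ) • y)
    have h2 : quad D ((k : ℝ) • y) = k ^ 2 * quad D y := by
      simp [quad, Matrix.mulVec_smul, sq, mul_assoc]
    linarith
  have hps : D.PosSemidef := by
    refine Matrix.PosSemidef.of_dotProduct_mulVec_nonneg ?_ fun x => ?_
    · rw [Matrix.IsHermitian, Matrix.conjTranspose_eq_transpose_of_trivial]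
      exact hD
    · simpa [quad] using hnn (WithLp.toLp 2 x)
  exact h0 (hps.trace_eq_zero_iff.1 (le_antisymm htr hps.trace_nonneg))

section Existence

variable {n : ℕ} {u : Space n → ℝ}

theorem integrable_weight (hu : Continuous u) (hg : StrongGrowth u)
    (B : Matrix (Fin n) (Fin n) ℝ) : Integrable (weight u B) := by
  simpa only [toEuclideanLin_one_apply] using (admissible_one B).integrable_weight hu hg

theorem integrable_weight_mul_norm_sq (hu : Continuous u) (hg : StrongGrowth u)
    (B : Matrix (Fin n) (Fin n) ℝ) : Integrable fun y => weight u B y * ‖y‖ ^ 2 := by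
  simpa only [toEuclideanLin_one_apply, mul_comm] using
    (admissible_one B).integrable_norm_sq_mul_weight hu hg

theorem continuous_partitionFn (hu : Continuous u) (hg : StrongGrowth u) :
    Continuous (partitionFn u) := by
  refine continuous_iff_continuousAt.2 fun B => ?_
  have h := (admissible_one B).continuousAt_partitionFn hu hg
  have h2 := ContinuousAt.comp (f := fun B : Matrix (Fin n) (Fin n) ℝ =>
    ((1 : Matrix (Fin n) (Fin n) ℝ), B)) h (Continuous.prodMk_right _).continuousAt
  simpa only [Function.comp_def, toEuclideanLin_one_apply] using h2

/-- Coercivity along rays: on the nonempty open set where `quad D < D.trace` the weight grows with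
`k`, and `exp s ≥ s` makes the growth at least linear. -/
theorem exists_lt_partitionFn_smul (hu : Continuous u) {D : Matrix (Fin n) (Fin n) ℝ}
    (hD : D.IsSymm) (h0 : D ≠ 0) {M : ENNReal} (hM : M ≠ ⊤) :
    ∃ k : ℕ, M < partitionFn u ((k : ℝ) • D) := by
  set q : Space n → ℝ := fun y => Real.exp (-u y) * (D.trace - quad D y) with hq
  have hqc : Continuous q := by fun_prop
  have hpos : ∫⁻ y, ENNReal.ofReal (q y) ≠ 0 := by
    refine ((lintegral_pos_iff_support hqc.measurable.ennreal_ofReal).2 ?_).ne'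
    obtain ⟨y, hy⟩ := exists_quad_lt_trace hD h0
    refine lt_of_lt_of_le ((isOpen_lt continuous_const hqc).measure_pos volume
      (U := {y | 0 < q y}) ⟨y, mul_pos (Real.exp_pos _) (sub_pos.2 hy)⟩)
      (measure_mono fun z hz => ?_)
    simpa using hz
  obtain ⟨k, hk⟩ := ENNReal.exists_nat_mul_gt hpos hM
  refine ⟨k, hk.trans_le ?_⟩
  rw [← lintegral_const_mul _ hqc.measurable.ennreal_ofReal]
  refine lintegral_mono fun y => ?_
  rw [← ENNReal.ofReal_natCast, ← ENNReal.ofReal_mul (Nat.cast_nonneg k)]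
  refine ENNReal.ofReal_le_ofReal ?_
  have hw : weight u ((k : ℝ) • D) y = Real.exp (-u y) * Real.exp (k * (D.trace - quad D y)) := by
    rw [weight, ← Real.exp_add, quad_smul, Matrix.trace_smul, smul_eq_mul]
    ring_nf
  rw [hw, hq, mul_left_comm]
  refine mul_le_mul_of_nonneg_left ?_ (Real.exp_nonneg _)
  linarith [Real.add_one_le_exp (k * (D.trace - quad D y))]

/-- The sublevel set of `0` is closed and convex; if it were unbounded, it would contain a whole
ray, contradicting growth along rays. -/
theorem exists_isMinOn_partitionFn (hu : Continuous u) (hg : StrongGrowth u) :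
    ∃ B : Matrix (Fin n) (Fin n) ℝ, B.IsSymm ∧
      ∀ B' : Matrix (Fin n) (Fin n) ℝ, B'.IsSymm → partitionFn u B ≤ partitionFn u B' := by
  have hF := continuous_partitionFn hu hg
  have hprop : ProperSpace (Matrix (Fin n) (Fin n) ℝ) := FiniteDimensional.proper ℝ _
  set S : Set (Matrix (Fin n) (Fin n) ℝ) :=
    {B | B.IsSymm} ∩ {B | partitionFn u B ≤ partitionFn u 0} with hS
  have hScl : IsClosed S := (isClosed_isSymm n).inter (isClosed_le hF continuous_const)
  have h0S : (0 : Matrix (Fin n) (Fin n) ℝ) ∈ S := ⟨Matrix.isSymm_zero, le_refl (partitionFn u 0)⟩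
  have htop : partitionFn u 0 ≠ ⊤ := (integrable_weight_iff hu 0).1 (integrable_weight hu hg 0)
  have hbdd : Bornology.IsBounded S := by
    by_contra hunb
    have hex : ∀ k : ℕ, ∃ B ∈ S, (k : ℝ) < ‖B‖ := fun k => by
      by_contra! hk
      exact hunb (isBounded_iff_forall_norm_le.2 ⟨k, hk⟩)
    choose b hbS hbk using hex
    have hbpos : ∀ k, 0 < ‖b k‖ := fun k => (Nat.cast_nonneg k).trans_lt (hbk k)
    -- A limit of normalised elements is a recession direction of the sublevel set.
    obtain ⟨d, hd, φ, hφ, hlim⟩ := (isCompact_sphere (0 : Matrix (Fin n) (Fin n) ℝ) 1).tendsto_subseq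
      (x := fun k => ‖b k‖⁻¹ • b k) fun k => by
        rw [mem_sphere_zero_iff_norm, norm_smul, norm_inv, norm_norm,
          inv_mul_cancel₀ (hbpos k).ne']
    have hdsym : d.IsSymm := (isClosed_isSymm n).mem_of_tendsto hlim
      (Eventually.of_forall fun k => (hbS (φ k)).1.smul _)
    have hd0 : d ≠ 0 := by
      rintro rfl
      simp at hd
    obtain ⟨k, hk⟩ := exists_lt_partitionFn_smul hu hdsym hd0 htop
    have hmem : (k : ℝ) • d ∈ S := by
      refine hScl.mem_of_tendsto (hlim.const_smul (k : ℝ)) ?_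
      filter_upwards [eventually_ge_atTop k] with j hj
      -- For large `j`, `k` times the unit vector lies on the segment from `0` to `b (φ j)`, hence
      -- in the sublevel set.
      have hle : (k : ℝ) * ‖b (φ j)‖⁻¹ ≤ 1 := by
        rw [← div_eq_mul_inv, div_le_one (hbpos _)]
        have h1 : (k : ℝ) ≤ (φ j : ℝ) := by exact_mod_cast hj.trans (hφ.id_le j)
        exact h1.trans (hbk (φ j)).le
      refine ⟨((hbS (φ j)).1.smul _).smul _, ?_⟩
      have hcc := partitionFn_convexComb_le_max hu 0 (b (φ j)) (sub_nonneg.2 hle)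
        (mul_nonneg (Nat.cast_nonneg k) (inv_nonneg.2 (norm_nonneg _))) (sub_add_cancel _ _)
      rw [smul_zero, zero_add, max_eq_left (hbS (φ j)).2] at hcc
      simpa only [Function.comp_apply, smul_smul, Set.mem_ofPred_eq] using hcc
    exact absurd hmem.2 (not_le.2 hk)
  obtain ⟨B, hB, hmin⟩ := (Metric.isCompact_of_isClosed_isBounded hScl hbdd).exists_isMinOn
    ⟨0, h0S⟩ hF.continuousOn
  refine ⟨B, hB.1, fun B' hB' => ?_⟩
  by_cases hle : partitionFn u B' ≤ partitionFn u 0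
  · exact hmin ⟨hB', hle⟩
  · exact hB.2.trans (not_le.1 hle).le

/-- Maximum entropy: a potential of strong growth can be corrected by a quadratic form so that its
Gibbs measure has second-moment matrix `1`. -/
theorem exists_isotropic (hu : Continuous u) (hg : StrongGrowth u) :
    ∃ B : Matrix (Fin n) (Fin n) ℝ, B.IsSymm ∧ Isotropic u B := by
  obtain ⟨B, hB, hmin⟩ := exists_isMinOn_partitionFn hu hg
  refine ⟨B, hB, integrable_weight hu hg B, integrable_weight_mul_norm_sq hu hg B, fun a => ?_⟩
  -- Perturbing the minimiser along the rank-one form `⟨a, y⟩²` gives the second moment in direction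
  -- `a` as the first-order condition.
  set D := Matrix.vecMulVec a.ofLp a.ofLp with hD
  have hDs : D.IsSymm := Matrix.transpose_vecMulVec _ _
  set X : Space n → ℝ := fun y => D.trace - quad D y with hX
  have hexp : ∀ t : ℝ, (fun y => weight u B y * Real.exp (t * X y)) = weight u (B + t • D) :=
    fun t => by
      ext y
      simp only [weight, hX, quad_add, quad_smul, Matrix.trace_add, Matrix.trace_smul,
        smul_eq_mul, ← Real.exp_add]
      ring_nf
  have hset : ProbabilityTheory.integrableExpSet X (gibbs u B) = Set.univ := by
    refine Set.eq_univ_of_forall fun t => ?_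
    rw [ProbabilityTheory.integrableExpSet, Set.mem_ofPred_eq, integrable_gibbs_iff hu, hexp]
    exact integrable_weight hu hg _
  have hmgf : ∀ t, ProbabilityTheory.mgf X (gibbs u B) t = ∫ y, weight u (B + t • D) y :=
    fun t => by rw [ProbabilityTheory.mgf, integral_gibbs hu, hexp]
  -- `t ↦ partitionFn u (B + t • D)` is a moment generating function of `X`, which provides
  -- differentiation under the integral.
  have hder : deriv (ProbabilityTheory.mgf X (gibbs u B)) 0 = 0 := by
    refine IsLocalMin.deriv_eq_zero (Eventually.of_forall fun t => ?_)
    rw [hmgf, hmgf, zero_smul, add_zero]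
    have h := hmin (B + t • D) (hB.add (hDs.smul t))
    rw [partitionFn_eq_ofReal (integrable_weight hu hg _),
      partitionFn_eq_ofReal (integrable_weight hu hg _)] at h
    exact (ENNReal.ofReal_le_ofReal_iff (integral_nonneg fun y => (weight_pos _ _ y).le)).1 h
  rw [ProbabilityTheory.deriv_mgf_zero (by rw [hset, interior_univ]; trivial),
    integral_gibbs hu] at hder
  have hi := integrable_weight hu hg B
  have hq : Integrable fun y => weight u B y * quad D y :=
    (integrable_gibbs_iff hu _).1 (integrable_quad
      ((integrable_gibbs_iff hu _).2 (integrable_weight_mul_norm_sq hu hg B)) D)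
  simp only [hX, mul_sub] at hder
  rw [integral_sub (hi.mul_const _) hq, integral_mul_const, trace_vecMulVec_self] at hder
  simp only [quad_vecMulVec, hD] at hder
  linarith

end Existence

end

/-! ### Moments of the standard Gaussian -/

section

open scoped Matrix.Norms.Elementwise

section StandardGaussian

variable {V : Type*} [NormedAddCommGroup V] [InnerProductSpace ℝ V] [FiniteDimensional ℝ V]
  [MeasurableSpace V] [BorelSpace V]

theorem integrable_inner_mul {f : V → ℝ} (hf : Integrable f) (h : Integrable fun y => f y * ‖y‖ ^ 2)
    (a : V) : Integrable fun y => f y * inner ℝ a y := by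
  refine ((hf.norm.add h.norm).const_mul ‖a‖).mono' (hf.1.mul (by fun_prop))
    (Eventually.of_forall fun y => ?_)
  have h1 : |inner ℝ a y| ≤ ‖a‖ * (1 + ‖y‖ ^ 2) := by
    refine (abs_real_inner_le_norm a y).trans (mul_le_mul_of_nonneg_left ?_ (norm_nonneg _))
    nlinarith [sq_nonneg (‖y‖ - 1), norm_nonneg y]
  simp only [norm_mul, Real.norm_eq_abs, Pi.add_apply, abs_pow, abs_norm]
  calc |f y| * |inner ℝ a y| ≤ |f y| * (‖a‖ * (1 + ‖y‖ ^ 2)) :=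
        mul_le_mul_of_nonneg_left h1 (abs_nonneg _)
    _ = _ := by ring

theorem integrable_inner_sq_mul {f : V → ℝ} (hf : Integrable f)
    (h : Integrable fun y => f y * ‖y‖ ^ 2) (a : V) :
    Integrable fun y => f y * inner ℝ a y ^ 2 := by
  refine (h.norm.const_mul (‖a‖ ^ 2)).mono' (hf.1.mul (by fun_prop))
    (Eventually.of_forall fun y => ?_)
  have h1 : inner ℝ a y ^ 2 ≤ ‖a‖ ^ 2 * ‖y‖ ^ 2 := by
    rw [← mul_pow, ← sq_abs]
    exact pow_le_pow_left₀ (abs_nonneg _) (abs_real_inner_le_norm a y) 2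
  simp only [norm_mul, Real.norm_eq_abs, abs_pow, abs_norm, sq_abs]
  calc |f y| * inner ℝ a y ^ 2 ≤ |f y| * (‖a‖ ^ 2 * ‖y‖ ^ 2) :=
        mul_le_mul_of_nonneg_left h1 (abs_nonneg _)
    _ = _ := by ring

theorem integrable_gaussian : Integrable fun y : V => Real.exp (-(1 / 2) * ‖y‖ ^ 2) :=
  integrable_exp_neg_mul_norm_sq one_half_pos

theorem integrable_gaussian_mul_norm_sq :
    Integrable fun y : V => Real.exp (-(1 / 2) * ‖y‖ ^ 2) * ‖y‖ ^ 2 := by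
  simpa only [mul_comm] using integrable_norm_sq_mul_exp (V := V) one_half_pos

theorem integral_gaussian_mul_inner (a : V) :
    ∫ y : V, Real.exp (-(1 / 2) * ‖y‖ ^ 2) * inner ℝ a y = 0 := by
  have h := integral_neg_eq_self (fun y : V => Real.exp (-(1 / 2) * ‖y‖ ^ 2) * inner ℝ a y) volume
  simp only [norm_neg, inner_neg_right, mul_neg, integral_neg] at h
  linarith

/-- Integration by parts in direction `a`: differentiating the Gaussian produces the factor `-⟨a,
y⟩`. -/
theorem integral_gaussian_mul_inner_sq (a : V) :
    ∫ y : V, Real.exp (-(1 / 2) * ‖y‖ ^ 2) * inner ℝ a y ^ 2 =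
      ‖a‖ ^ 2 * ∫ y : V, Real.exp (-(1 / 2) * ‖y‖ ^ 2) := by
  have hf : ∀ y : V, HasFDerivAt (fun y : V => inner ℝ a y) (innerSL ℝ a) y := fun y =>
    (innerSL ℝ a).hasFDerivAt
  have hγ : ∀ y : V, HasFDerivAt (fun y : V => Real.exp (-(1 / 2) * ‖y‖ ^ 2))
      (Real.exp (-(1 / 2) * ‖y‖ ^ 2) • ((-(1 / 2) : ℝ) • (2 • innerSL ℝ y))) y := fun y =>
    (((hasStrictFDerivAt_norm_sq y).hasFDerivAt).const_mul _).exp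
  have hfa : ∀ y : V, fderiv ℝ (fun y : V => inner ℝ a y) y a = ‖a‖ ^ 2 := fun y => by
    rw [(hf y).fderiv, innerSL_apply_apply, real_inner_self_eq_norm_sq]
  have hγa : ∀ y : V, fderiv ℝ (fun y : V => Real.exp (-(1 / 2) * ‖y‖ ^ 2)) y a =
      -(Real.exp (-(1 / 2) * ‖y‖ ^ 2) * inner ℝ a y) := fun y => by
    rw [(hγ y).fderiv]
    simp [real_inner_comm]
  have hI2 := integrable_inner_sq_mul (V := V) integrable_gaussian integrable_gaussian_mul_norm_sq a
  have heq : ∀ y : V, inner ℝ a y * -(Real.exp (-(1 / 2) * ‖y‖ ^ 2) * inner ℝ a y) =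
      -(Real.exp (-(1 / 2) * ‖y‖ ^ 2) * inner ℝ a y ^ 2) := fun y => by ring
  have key := integral_mul_fderiv_eq_neg_fderiv_mul_of_integrable (μ := (volume : Measure V))
    (f := fun y : V => inner ℝ a y) (g := fun y : V => Real.exp (-(1 / 2) * ‖y‖ ^ 2)) (v := a)
    (by simp only [hfa]; exact integrable_gaussian.const_mul _)
    (by simp only [hγa, heq]; exact hI2.neg)
    ((integrable_inner_mul integrable_gaussian integrable_gaussian_mul_norm_sq a).congr
      (Eventually.of_forall fun y => mul_comm _ _))
    (fun y _ => (hf y).differentiableAt) (fun y _ => (hγ y).differentiableAt)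
  simp only [hfa, hγa, heq, integral_neg, integral_const_mul] at key
  linarith

end StandardGaussian

theorem inner_toEuclideanLin {m n : ℕ} (T : Matrix (Fin m) (Fin n) ℝ) (x : Space n) (y : Space m) :
    inner ℝ (Matrix.toEuclideanLin T x) y = inner ℝ x (Matrix.toEuclideanLin T.transpose y) := by
  rw [← Matrix.conjTranspose_eq_transpose_of_trivial,
    Matrix.toEuclideanLin_conjTranspose_eq_adjoint, LinearMap.adjoint_inner_right]

theorem toEuclideanLin_mul_apply {l m n : ℕ} (S : Matrix (Fin l) (Fin m) ℝ)
    (T : Matrix (Fin m) (Fin n) ℝ) (x : Space n) :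
    Matrix.toEuclideanLin (S * T) x = Matrix.toEuclideanLin S (Matrix.toEuclideanLin T x) := by
  change WithLp.toLp 2 ((S * T).mulVec x.ofLp) = WithLp.toLp 2 (S.mulVec (T.mulVec x.ofLp))
  rw [Matrix.mulVec_mulVec]

theorem quad_mul_mul_transpose {m n : ℕ} (V : Matrix (Fin m) (Fin n) ℝ)
    (B : Matrix (Fin n) (Fin n) ℝ) (y : Space m) :
    quad (V * B * V.transpose) y = quad B (Matrix.toEuclideanLin V.transpose y) := by
  have h : (Matrix.toEuclideanLin V.transpose y).ofLp = V.transpose.mulVec y.ofLp := rfl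
  rw [quad, quad, h, ← Matrix.mulVec_mulVec, ← Matrix.mulVec_mulVec, Matrix.dotProduct_mulVec,
    ← Matrix.mulVec_transpose]

/-! ### Splitting off Gaussian directions -/

section Splitting

variable {N p : ℕ} {V : Matrix (Fin N) (Fin p) ℝ}

theorem inner_toEuclideanLin_of_isometry (hV : V.transpose * V = 1) (x y : Space p) :
    inner ℝ (Matrix.toEuclideanLin V x) (Matrix.toEuclideanLin V y) = inner ℝ x y := by
  rw [inner_toEuclideanLin, ← toEuclideanLin_mul_apply, hV, toEuclideanLin_one_apply]

/-- The orthogonal splitting of `Space N` along the range of an isometry `V`. -/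
theorem exists_orthogonal_splitting (hV : V.transpose * V = 1) :
    ∃ (R : Submodule ℝ (Space N)) (Θ : Space p × R → Space N),
      p + Module.finrank ℝ R = N ∧ MeasurePreserving Θ ∧ MeasurableEmbedding Θ ∧
      Function.Surjective Θ ∧
      (∀ q q', inner ℝ (Θ q) (Θ q') = inner ℝ q.1 q'.1 + inner ℝ q.2 q'.2) ∧
      ∀ q, Matrix.toEuclideanLin V.transpose (Θ q) = q.1 := by
  set ι : Space p →ₗᵢ[ℝ] Space N :=
    (Matrix.toEuclideanLin V).isometryOfInner (inner_toEuclideanLin_of_isometry hV) with hι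
  set K := LinearMap.range ι.toLinearMap with hK
  set e : Space p ≃ₗᵢ[ℝ] K := ι.equivRange
  set Θ : Space p × Kᗮ → Space N := fun q => ι q.1 + q.2 with hΘ
  have horth : ∀ (x : Space p) (w : Kᗮ), inner ℝ (ι x) (w : Space N) = 0 := fun x w =>
    (Submodule.mem_orthogonal K (w : Space N)).1 w.2 _ ⟨x, rfl⟩
  have hΘeq : Θ = K.orthogonalDecomposition.symm ∘ WithLp.toLp 2 ∘ Prod.map e id := by
    ext1 q
    simp only [Function.comp_apply, Submodule.orthogonalDecomposition_symm_apply]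
    rfl
  have hinner : ∀ q q', inner ℝ (Θ q) (Θ q') = inner ℝ q.1 q'.1 + inner ℝ q.2 q'.2 :=
    fun q q' => by
      have h1 := horth q'.1 q.2
      rw [real_inner_comm] at h1
      simp only [hΘ, inner_add_left, inner_add_right, ι.inner_map_map, horth, h1,
        Submodule.coe_inner]
      ring
  have hbij : Function.Bijective Θ := by
    rw [hΘeq]
    exact K.orthogonalDecomposition.symm.bijective.comp ((WithLp.toLp_bijective 2).comp
      (e.bijective.prodMap Function.bijective_id))
  have hcont : Continuous Θ := by
    have := ι.continuous
    fun_prop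
  refine ⟨Kᗮ, Θ, ?_, ?_, hcont.measurableEmbedding hbij.1, hbij.2, hinner, fun q => ?_⟩
  · have h1 := Submodule.finrank_add_finrank_orthogonal K
    rw [← e.toLinearEquiv.finrank_eq] at h1
    simpa using h1
  · rw [hΘeq]
    exact K.orthogonalDecomposition.symm.measurePreserving.comp
      ((WithLp.volume_preserving_toLp _ _).comp
        (e.measurePreserving.prod (MeasurePreserving.id volume)))
  · refine ext_inner_left ℝ fun x => ?_
    rw [← inner_toEuclideanLin]
    change inner ℝ (ι x) (ι q.1 + q.2) = _
    rw [inner_add_right, ι.inner_map_map, horth, add_zero]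

/-- Extension of a quadratic form along an isometry by half of the squared norm on the
orthogonal complement. -/
def liftForm (V : Matrix (Fin N) (Fin p) ℝ) (B : Matrix (Fin p) (Fin p) ℝ) :
    Matrix (Fin N) (Fin N) ℝ :=
  V * B * V.transpose + (1 / 2 : ℝ) • (1 - V * V.transpose)

theorem liftForm_isSymm {B : Matrix (Fin p) (Fin p) ℝ} (hB : B.IsSymm) :
    (liftForm V B).IsSymm := by
  refine Matrix.IsSymm.add ?_ (Matrix.IsSymm.smul ?_ _)
  · rw [Matrix.IsSymm, Matrix.transpose_mul, Matrix.transpose_mul, Matrix.transpose_transpose,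
      hB.eq, Matrix.mul_assoc]
  · refine Matrix.isSymm_one.sub ?_
    rw [Matrix.IsSymm, Matrix.transpose_mul, Matrix.transpose_transpose]

theorem quad_liftForm (B : Matrix (Fin p) (Fin p) ℝ) (y : Space N) :
    quad (liftForm V B) y = quad B (Matrix.toEuclideanLin V.transpose y) +
      1 / 2 * (‖y‖ ^ 2 - ‖Matrix.toEuclideanLin V.transpose y‖ ^ 2) := by
  rw [liftForm, quad_add, quad_smul, quad_sub, quad_one, quad_mul_mul_transpose,
    norm_toEuclideanLin_sq, Matrix.transpose_transpose]

theorem trace_liftForm (hV : V.transpose * V = 1) (B : Matrix (Fin p) (Fin p) ℝ) :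
    (liftForm V B).trace = B.trace + 1 / 2 * ((N : ℝ) - p) := by
  rw [liftForm, Matrix.trace_add, Matrix.trace_smul, Matrix.trace_sub, Matrix.trace_mul_cycle, hV,
    Matrix.one_mul, Matrix.trace_mul_comm V, hV]
  simp

/-- In orthogonal coordinates the weight is a product of the `p`-dimensional weight and a standard
Gaussian. Both factors are isotropic, and cross moments vanish because the Gaussian is centred. The
Gaussian integral gives `(2π)^((N-p)/2)` and the trace of half the complementary projection gives
the power of `e`. -/
theorem Isotropic.lift {u : Space p → ℝ} {B : Matrix (Fin p) (Fin p) ℝ} (h : Isotropic u B)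
    (hV : V.transpose * V = 1) :
    Isotropic (fun y => u (Matrix.toEuclideanLin V.transpose y)) (liftForm V B) ∧
      ∫ y, weight (fun y => u (Matrix.toEuclideanLin V.transpose y)) (liftForm V B) y =
        (2 * Real.pi * Real.exp 1) ^ (((N : ℝ) - p) / 2) * ∫ z, weight u B z := by
  obtain ⟨R, Θ, hdim, hmp, hemb, hsurj, hinner, hproj⟩ := exists_orthogonal_splitting hV
  set w' := weight (fun y => u (Matrix.toEuclideanLin V.transpose y)) (liftForm V B) with hw'
  set w := weight u B with hw
  set γ : R → ℝ := fun y => Real.exp (-(1 / 2) * ‖y‖ ^ 2) with hγ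
  set κ : ℝ := Real.exp (1 / 2 * ((N : ℝ) - p)) with hκ
  have hnorm : ∀ q, ‖Θ q‖ ^ 2 = ‖q.1‖ ^ 2 + ‖q.2‖ ^ 2 := fun q => by
    rw [← real_inner_self_eq_norm_sq, hinner, real_inner_self_eq_norm_sq,
      real_inner_self_eq_norm_sq]
  have hfac : ∀ q, w' (Θ q) = κ * (w q.1 * γ q.2) := fun q => by
    simp only [hw', hw, hγ, hκ, weight, hproj, quad_liftForm, trace_liftForm hV, hnorm,
      ← Real.exp_add]
    ring_nf
  have hγi : Integrable γ := integrable_gaussian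
  have hγ2 : Integrable fun y => γ y * ‖y‖ ^ 2 := integrable_gaussian_mul_norm_sq
  have hprod : Integrable (fun q : Space p × R => w q.1 * γ q.2) (volume.prod volume) :=
    h.1.mul_prod hγi
  have hint : ∫ y, w' y = κ * ((∫ z, w z) * ∫ y, γ y) := by
    rw [← hmp.integral_comp hemb]
    simp only [hfac]
    rw [integral_const_mul, Measure.volume_eq_prod, integral_prod_mul]
  have hΓ : ∫ y, γ y = (2 * Real.pi) ^ (((N : ℝ) - p) / 2) := by
    rw [hγ, GaussianFourier.integral_rexp_neg_mul_sq_norm one_half_pos]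
    have : (Module.finrank ℝ R : ℝ) = (N : ℝ) - p := by
      exact eq_sub_of_add_eq' (by exact_mod_cast hdim)
    rw [this]
    congr 1
    ring
  refine ⟨⟨?_, ?_, fun a => ?_⟩, ?_⟩
  · change Integrable w'
    rw [← hmp.integrable_comp_emb hemb]
    simp only [Function.comp_def, hfac]
    exact hprod.const_mul κ
  · change Integrable fun y => w' y * ‖y‖ ^ 2
    rw [← hmp.integrable_comp_emb hemb]
    have heq : ∀ q, w' (Θ q) * ‖Θ q‖ ^ 2 =
        κ * ((w q.1 * ‖q.1‖ ^ 2) * γ q.2 + w q.1 * (γ q.2 * ‖q.2‖ ^ 2)) := fun q => by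
      rw [hfac, hnorm]; ring
    simp only [Function.comp_def, heq]
    exact ((h.2.1.mul_prod hγi).add (h.1.mul_prod hγ2)).const_mul κ
  · obtain ⟨a, rfl⟩ := hsurj a
    change ∫ y, w' y * inner ℝ (Θ a) y ^ 2 = ‖Θ a‖ ^ 2 * ∫ y, w' y
    rw [← hmp.integral_comp hemb]
    have heq : ∀ q, w' (Θ q) * inner ℝ (Θ a) (Θ q) ^ 2 =
        κ * (((w q.1 * inner ℝ a.1 q.1 ^ 2) * γ q.2 +
          2 * ((w q.1 * inner ℝ a.1 q.1) * (γ q.2 * inner ℝ a.2 q.2))) +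
          w q.1 * (γ q.2 * inner ℝ a.2 q.2 ^ 2)) := fun q => by
      rw [hfac, hinner]; ring
    have i1 : Integrable (fun q : Space p × R => (w q.1 * inner ℝ a.1 q.1 ^ 2) * γ q.2)
        (volume.prod volume) := (integrable_inner_sq_mul h.1 h.2.1 a.1).mul_prod hγi
    have i2 : Integrable (fun q : Space p × R =>
        2 * ((w q.1 * inner ℝ a.1 q.1) * (γ q.2 * inner ℝ a.2 q.2))) (volume.prod volume) :=
      ((integrable_inner_mul h.1 h.2.1 a.1).mul_prod
        (integrable_inner_mul hγi hγ2 a.2)).const_mul 2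
    have i3 : Integrable (fun q : Space p × R => w q.1 * (γ q.2 * inner ℝ a.2 q.2 ^ 2))
        (volume.prod volume) := h.1.mul_prod (integrable_inner_sq_mul hγi hγ2 a.2)
    simp only [heq]
    rw [integral_const_mul, Measure.volume_eq_prod,
      integral_add (f := fun q : Space p × R => (w q.1 * inner ℝ a.1 q.1 ^ 2) * γ q.2 +
        2 * ((w q.1 * inner ℝ a.1 q.1) * (γ q.2 * inner ℝ a.2 q.2))) (i1.add i2) i3,
      integral_add i1 i2, integral_const_mul,
      integral_prod_mul (fun z => w z * inner ℝ a.1 z ^ 2) γ,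
      integral_prod_mul (fun z => w z * inner ℝ a.1 z) (fun y => γ y * inner ℝ a.2 y),
      integral_prod_mul w (fun y => γ y * inner ℝ a.2 y ^ 2), h.2.2,
      integral_gaussian_mul_inner, integral_gaussian_mul_inner_sq, hint, hnorm]
    ring
  · rw [hint, hΓ, Real.mul_rpow (by positivity) (Real.exp_nonneg _), ← Real.exp_mul, one_mul, hκ,
      show (1 / 2 * ((N : ℝ) - p)) = ((N : ℝ) - p) / 2 by ring]
    ring

end Splitting

end

/-! ### Change of variables and the dual formula -/

/-- Half of the potential still grows strongly, and the other half absorbs the linear factor through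
`s ≤ 2 exp (s / 2)`. -/
theorem integrable_weight_mul_self {n : ℕ} {u : Space n → ℝ} (hu : Continuous u)
    (hg : StrongGrowth u) (B : Matrix (Fin n) (Fin n) ℝ) :
    Integrable fun y => weight u B y * u y := by
  obtain ⟨b, hb⟩ := hg 0
  have hg2 : StrongGrowth fun y => u y / 2 := fun α => by
    obtain ⟨b, hb⟩ := hg (2 * α)
    exact ⟨b / 2, fun y => by linarith [hb y]⟩
  have hu2 : Continuous fun y => u y / 2 := by fun_prop
  refine (((integrable_weight hu hg B).const_mul |b|).add
    ((integrable_weight hu2 hg2 B).const_mul (2 * Real.exp (b / 2)))).mono'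
    ((continuous_weight hu B).mul hu).aestronglyMeasurable (Eventually.of_forall fun y => ?_)
  have h0 : 0 ≤ u y + b := by simpa using hb y
  have habs : |u y| ≤ |b| + (u y + b) := by
    calc |u y| = |(u y + b) + -b| := by ring_nf
      _ ≤ |u y + b| + |-b| := abs_add_le _ _
      _ = |b| + (u y + b) := by rw [abs_neg, abs_of_nonneg h0, add_comm]
  have hexp : u y + b ≤ 2 * Real.exp ((u y + b) / 2) := by
    linarith [Real.add_one_le_exp ((u y + b) / 2)]
  have hw : weight u B y * Real.exp ((u y + b) / 2) =
      Real.exp (b / 2) * weight (fun y => u y / 2) B y := by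
    simp only [weight, ← Real.exp_add]
    ring_nf
  simp only [Pi.add_apply, norm_mul, Real.norm_eq_abs, abs_of_pos (weight_pos u B y)]
  calc weight u B y * |u y| ≤ weight u B y * (|b| + 2 * Real.exp ((u y + b) / 2)) :=
        mul_le_mul_of_nonneg_left (by linarith) (weight_pos u B y).le
    _ = |b| * weight u B y + 2 * (weight u B y * Real.exp ((u y + b) / 2)) := by ring
    _ = _ := by rw [hw]; ring

theorem trace_cfc_log {n : ℕ} {G : Matrix (Fin n) (Fin n) ℝ} (hG : G.PosDef) :
    (cfc Real.log G).trace = Real.log G.det := by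
  rw [hG.1.cfc_eq, Matrix.IsHermitian.cfc, Unitary.conjStarAlgAut_apply, Matrix.trace_mul_cycle,
    Unitary.coe_star_mul_self, Matrix.one_mul, Matrix.trace_diagonal,
    hG.1.det_eq_prod_eigenvalues]
  simp only [Function.comp_apply, RCLike.ofReal_real_eq_id, id]
  rw [Real.log_prod fun i _ => (hG.eigenvalues_pos i).ne']

section ChangeOfVariables

variable {n : ℕ} {S : Matrix (Fin n) (Fin n) ℝ}

theorem measurableEmbedding_toEuclideanLin (hS : S.det ≠ 0) :
    MeasurableEmbedding (Matrix.toEuclideanLin S : Space n → Space n) := by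
  refine (LinearMap.continuous_of_finiteDimensional _).measurableEmbedding ?_
  refine Function.LeftInverse.injective (g := Matrix.toEuclideanLin S⁻¹) fun y => ?_
  rw [← toEuclideanLin_mul_apply, Matrix.nonsing_inv_mul _ (isUnit_iff_ne_zero.2 hS),
    toEuclideanLin_one_apply]

theorem map_toEuclideanLin_volume (hS : 0 < S.det) :
    Measure.map (Matrix.toEuclideanLin S) (volume : Measure (Space n)) =
      ENNReal.ofReal S.det⁻¹ • volume := by
  have hdet : LinearMap.det (Matrix.toEuclideanLin S) = S.det := LinearMap.det_toLpLin 2 S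
  rw [Measure.map_linearMap_addHaar_eq_smul_addHaar volume (by rw [hdet]; exact hS.ne'), hdet,
    abs_of_pos (inv_pos.2 hS)]

theorem integral_comp_toEuclideanLin (hS : 0 < S.det) (f : Space n → ℝ) :
    ∫ x, f x = S.det * ∫ y, f (Matrix.toEuclideanLin S y) := by
  rw [← (measurableEmbedding_toEuclideanLin hS.ne').integral_map, map_toEuclideanLin_volume hS,
    integral_smul_measure, ENNReal.toReal_ofReal (inv_pos.2 hS).le, smul_eq_mul,
    mul_inv_cancel_left₀ hS.ne']

theorem integrable_comp_toEuclideanLin_iff (hS : 0 < S.det) (f : Space n → ℝ) :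
    Integrable (fun y => f (Matrix.toEuclideanLin S y)) ↔ Integrable f := by
  change Integrable (f ∘ Matrix.toEuclideanLin S) ↔ _
  rw [← (measurableEmbedding_toEuclideanLin hS.ne').integrable_map_iff,
    map_toEuclideanLin_volume hS, integrable_smul_measure
    (ENNReal.ofReal_pos.2 (inv_pos.2 hS)).ne' ENNReal.ofReal_ne_top]

theorem exists_norm_sq_le (hS : S.det ≠ 0) :
    ∃ κ : ℝ, 0 ≤ κ ∧ ∀ y : Space n, ‖y‖ ^ 2 ≤ κ * ‖Matrix.toEuclideanLin S y‖ ^ 2 := by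
  refine ⟨∑ i, ∑ j, |(S⁻¹.transpose * S⁻¹) i j|, by positivity, fun y => ?_⟩
  refine le_trans (le_of_eq ?_) ((le_abs_self _).trans (abs_quad_le _ _))
  rw [← norm_toEuclideanLin_sq, ← toEuclideanLin_mul_apply,
    Matrix.nonsing_inv_mul _ (isUnit_iff_ne_zero.2 hS), toEuclideanLin_one_apply]

theorem StrongGrowth.comp_toEuclideanLin {U : Space n → ℝ} (hg : StrongGrowth U)
    (hS : S.det ≠ 0) : StrongGrowth fun y => U (Matrix.toEuclideanLin S y) := fun α => by
  obtain ⟨κ, hκ, h⟩ := exists_norm_sq_le hS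
  obtain ⟨b, hb⟩ := hg (|α| * κ)
  refine ⟨b, fun y => le_trans ?_ (hb _)⟩
  rw [mul_assoc]
  exact (mul_le_mul_of_nonneg_right (le_abs_self α) (sq_nonneg _)).trans
    (mul_le_mul_of_nonneg_left (h y) (abs_nonneg α))

end ChangeOfVariables

theorem StrongGrowth.comp_isometry {N p : ℕ} {V : Matrix (Fin N) (Fin p) ℝ}
    (hV : V.transpose * V = 1) {U : Space N → ℝ} (hg : StrongGrowth U) :
    StrongGrowth fun y => U (Matrix.toEuclideanLin V y) := fun α => by
  obtain ⟨b, hb⟩ := hg α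
  refine ⟨b, fun y => ?_⟩
  have := hb (Matrix.toEuclideanLin V y)
  rwa [norm_toEuclideanLin_sq, hV, quad_one] at this

theorem quad_single {n : ℕ} (i j : Fin n) (x : Space n) :
    quad (Matrix.single i j 1) x = x i * x j := by
  rw [quad, Matrix.single_mulVec, one_mul]
  exact dotProduct_single _ _ _

/-- The Luttinger-Ward functional through the partition function of an isotropic Gibbs measure. -/
theorem lw_eq_of_isotropic {n : ℕ} {G S B : Matrix (Fin n) (Fin n) ℝ} {U : Space n → ℝ}
    (hU : Continuous U) (hg : StrongGrowth U) (hG : G.PosDef) (hSt : S.transpose = S)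
    (hSS : S * S = G) (hS : 0 < S.det)
    (hB : Isotropic (fun y => U (Matrix.toEuclideanLin S y)) B) :
    lw G U = ((2 * Real.log (∫ y, weight (fun y => U (Matrix.toEuclideanLin S y)) B y) -
      n * Real.log (2 * Real.pi * Real.exp 1) : ℝ) : EReal) := by
  set u : Space n → ℝ := fun y => U (Matrix.toEuclideanLin S y) with hu
  have huc : Continuous u := continuous_comp_toEuclideanLin hU S
  have hug : StrongGrowth u := hg.comp_toEuclideanLin hS.ne'
  set Z := ∫ y, weight u B y with hZ
  have hZpos : 0 < Z := hB.integral_weight_pos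
  have hunit : IsUnit S.det := isUnit_iff_ne_zero.2 hS.ne'
  -- The multiplier transported to the original variable; `c` then normalises the density, with
  -- `S.det` as Jacobian. Thus `c + tr (C G) = log Z + log S.det`.
  set C := S⁻¹ * B * S⁻¹ with hC
  set c := Real.log (Z * S.det) - B.trace with hc
  have hquad : ∀ y, quad C (Matrix.toEuclideanLin S y) = quad B y := fun y => by
    have h1 := quad_mul_mul_transpose S C y
    rw [hSt] at h1
    rw [← h1, hC, Matrix.mul_assoc, Matrix.mul_assoc, Matrix.nonsing_inv_mul _ hunit,
      Matrix.mul_one, ← Matrix.mul_assoc, Matrix.mul_nonsing_inv _ hunit, Matrix.one_mul]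
  have hdens : ∀ y, Real.exp (-(U (Matrix.toEuclideanLin S y) +
      quad C (Matrix.toEuclideanLin S y) + c)) = (Z * S.det)⁻¹ * weight u B y := fun y => by
    have h1 : (Z * S.det)⁻¹ = Real.exp (-Real.log (Z * S.det)) := by
      rw [Real.exp_neg, Real.exp_log (mul_pos hZpos hS)]
    rw [hquad, h1, weight, ← Real.exp_add, hc]
    simp only [hu]
    ring_nf
  have hZd : S.det * (Z * S.det)⁻¹ = Z⁻¹ := by field_simp
  obtain ⟨b, hb⟩ := hg 0
  have hCG : ∑ i, ∑ j, C i j * G i j = B.trace := by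
    have hGt : G.transpose = G := by rw [← hSS, Matrix.transpose_mul, hSt]
    have h1 : (C * G).trace = B.trace := by
      rw [← hSS, hC, ← Matrix.mul_assoc, Matrix.mul_assoc (S⁻¹ * B), Matrix.nonsing_inv_mul _ hunit,
        Matrix.mul_one, Matrix.trace_mul_cycle, Matrix.mul_nonsing_inv _ hunit, Matrix.one_mul]
    rw [← h1]
    nth_rewrite 2 [← hGt]
    simp [Matrix.trace, Matrix.mul_apply]
  have hF := dualFreeEnergy_eq_of_gibbs (G := G) hU (b := -b)
    (fun x => by have := hb x; linarith) C c
    (by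
      rw [← integrable_comp_toEuclideanLin_iff hS]
      simp only [hdens]
      exact hB.1.const_mul _)
    (by
      rw [integral_comp_toEuclideanLin hS]
      simp only [hdens]
      rw [integral_const_mul, ← mul_assoc, hZd, inv_mul_cancel₀ hZpos.ne'])
    (by
      rw [← integrable_comp_toEuclideanLin_iff hS]
      simp only [hdens, mul_assoc]
      exact (integrable_weight_mul_self huc hug B).const_mul _)
    (by
      rw [← integrable_comp_toEuclideanLin_iff hS]
      simp only [hdens, mul_assoc, norm_toEuclideanLin_sq]
      exact ((integrable_gibbs_iff huc _).1
        (integrable_quad (hB.integrable_norm_sq huc) _)).const_mul _)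
    (fun i j => by
      rw [integral_comp_toEuclideanLin hS]
      -- A product of coordinates after `S` is again a quadratic form in `y`, so isotropy evaluates
      -- its mean as a trace.
      have h1 : ∀ y : Space n, Matrix.toEuclideanLin S y i * Matrix.toEuclideanLin S y j =
          quad (S * Matrix.single i j 1 * S.transpose) y := fun y => by
        rw [quad_mul_mul_transpose, quad_single, hSt]
      simp only [hdens, h1, mul_assoc (Z * S.det)⁻¹]
      rw [integral_const_mul, ← mul_assoc, hZd, ← integral_gibbs huc, hB.integral_quad huc,
        Matrix.trace_mul_cycle, hSt, hSS, ← hZ, mul_comm _ Z, inv_mul_cancel_left₀ hZpos.ne']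
      have hGt : G.transpose = G := by rw [← hSS, Matrix.transpose_mul, hSt]
      rw [Matrix.trace_mul_comm, Matrix.trace_single_mul]
      simpa using congrFun (congrFun hGt i) j)
  have hdet : Real.log G.det = 2 * Real.log S.det := by
    rw [← hSS, Matrix.det_mul, Real.log_mul hS.ne' hS.ne', two_mul]
  rw [lw, hF, hCG, trace_cfc_log hG, hdet, show (2 : EReal) = ((2 : ℝ) : EReal) from rfl,
    ← EReal.coe_mul, ← EReal.coe_sub]
  congr 1
  rw [hc, Real.log_mul hZpos.ne' hS.ne']
  ring

/-! ### Square roots and the extended functional -/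

section Sqrt

open scoped MatrixOrder

variable {n : ℕ} {G : Matrix (Fin n) (Fin n) ℝ}

theorem sqrt_mul_sqrt (hG : G.PosSemidef) : CFC.sqrt G * CFC.sqrt G = G :=
  CFC.sqrt_mul_sqrt_self G (Matrix.nonneg_iff_posSemidef.2 hG)

theorem posSemidef_sqrt (G : Matrix (Fin n) (Fin n) ℝ) : (CFC.sqrt G).PosSemidef :=
  Matrix.nonneg_iff_posSemidef.1 (CFC.sqrt_nonneg G)

theorem transpose_sqrt (G : Matrix (Fin n) (Fin n) ℝ) :
    (CFC.sqrt G).transpose = CFC.sqrt G := by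
  rw [← Matrix.conjTranspose_eq_transpose_of_trivial]
  exact (posSemidef_sqrt G).1

theorem det_sqrt_pos (hG : G.PosDef) : 0 < (CFC.sqrt G).det := by
  refine lt_of_le_of_ne (posSemidef_sqrt G).det_nonneg fun h => ?_
  have h1 := congrArg Matrix.det (sqrt_mul_sqrt hG.posSemidef)
  rw [Matrix.det_mul, ← h, mul_zero] at h1
  exact hG.det_pos.ne h1

theorem sqrt_eq_of_isometry {N p : ℕ} {V : Matrix (Fin N) (Fin p) ℝ} (hV : V.transpose * V = 1)
    {G : Matrix (Fin p) (Fin p) ℝ} (hG : G.PosSemidef) :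
    CFC.sqrt (V * G * V.transpose) = V * CFC.sqrt G * V.transpose := by
  refine CFC.sqrt_unique ?_ (Matrix.nonneg_iff_posSemidef.2 ?_)
  · calc V * CFC.sqrt G * V.transpose * (V * CFC.sqrt G * V.transpose)
        = V * CFC.sqrt G * (V.transpose * V) * CFC.sqrt G * V.transpose := by
          simp only [Matrix.mul_assoc]
      _ = V * (CFC.sqrt G * CFC.sqrt G) * V.transpose := by
          rw [hV, Matrix.mul_one, Matrix.mul_assoc V]
      _ = V * G * V.transpose := by rw [sqrt_mul_sqrt hG]
  · rw [← Matrix.conjTranspose_eq_transpose_of_trivial]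
    exact (posSemidef_sqrt G).mul_mul_conjTranspose_same V

open scoped Matrix.Norms.L2Operator in
theorem continuousOn_sqrt (n : ℕ) :
    ContinuousOn (CFC.sqrt : Matrix (Fin n) (Fin n) ℝ → Matrix (Fin n) (Fin n) ℝ)
      {G | G.PosSemidef} := by
  simpa only [Matrix.nonneg_iff_posSemidef] using
    (CFC.continuousOn_sqrt (A := Matrix (Fin n) (Fin n) ℝ))

end Sqrt

open scoped MatrixOrder in
/-- The continuous extension of the Luttinger-Ward functional, in its dual form. -/
def lwExt {N : ℕ} (U : Space N → ℝ) (G : Matrix (Fin N) (Fin N) ℝ) : ℝ :=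
  2 * Real.log (minPartitionFn fun y => U (Matrix.toEuclideanLin (CFC.sqrt G) y)).toReal -
    N * Real.log (2 * Real.pi * Real.exp 1)

/-- On the complement the lifted form is coercive by itself. On the range of `V`, a large multiple
of `‖S z‖²`, with `S` invertible, outweighs `B` and the subtracted `1/2`. -/
theorem admissible_lift {N p : ℕ} {V : Matrix (Fin N) (Fin p) ℝ} (hV : V.transpose * V = 1)
    {S : Matrix (Fin p) (Fin p) ℝ} (hS : S.det ≠ 0) (B : Matrix (Fin p) (Fin p) ℝ) :
    Admissible (V * S * V.transpose) (liftForm V B) := by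
  obtain ⟨κ, hκ, h⟩ := exists_norm_sq_le hS
  set β := ∑ i, ∑ j, |B i j| with hβ
  have hβ0 : 0 ≤ β := by positivity
  refine ⟨(β + 1 / 2) * κ, 1 / 2, one_half_pos, fun y => ?_⟩
  set z := Matrix.toEuclideanLin V.transpose y with hz
  have hT : ‖Matrix.toEuclideanLin (V * S * V.transpose) y‖ ^ 2 =
      ‖Matrix.toEuclideanLin S z‖ ^ 2 := by
    rw [toEuclideanLin_mul_apply, toEuclideanLin_mul_apply, norm_toEuclideanLin_sq V, hV,
      quad_one]
  rw [quad_add, quad_smul, ← norm_toEuclideanLin_sq, hT, quad_liftForm, mul_assoc]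
  have h1 := (abs_le.1 (abs_quad_le B z)).1
  have h2 := mul_le_mul_of_nonneg_left (h z) (by positivity : (0 : ℝ) ≤ β + 1 / 2)
  linarith

open scoped MatrixOrder in
-- Both conclusions rest on the same lifted isotropic multiplier. The choices `V = 1`, `basisMatrix
-- v` and `padInclusion N p` give the extension property, the kernel strata and the block matrices.
theorem coe_lwExt_eq_lw_and_continuousWithinAt {N p : ℕ} {U : Space N → ℝ} (hU : Continuous U)
    (hg : StrongGrowth U) {V : Matrix (Fin N) (Fin p) ℝ} (hV : V.transpose * V = 1)
    {G : Matrix (Fin p) (Fin p) ℝ} (hG : G.PosDef) :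
    (lwExt U (V * G * V.transpose) : EReal) = lw G (fun x => U (Matrix.toEuclideanLin V x)) ∧
      ContinuousWithinAt (lwExt U) {G | G.PosSemidef} (V * G * V.transpose) := by
  set S := CFC.sqrt G with hS
  have hSdet : 0 < S.det := det_sqrt_pos hG
  have hVc := continuous_comp_toEuclideanLin (n := p) hU V
  have hVg := hg.comp_isometry hV
  obtain ⟨B, hBs, hB⟩ := exists_isotropic (continuous_comp_toEuclideanLin hVc S)
    (hVg.comp_toEuclideanLin hSdet.ne')
  have hlw := lw_eq_of_isotropic hVc hVg hG (transpose_sqrt G) (sqrt_mul_sqrt hG.posSemidef)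
    hSdet hB
  set Z := ∫ y, weight (fun y => U (Matrix.toEuclideanLin V (Matrix.toEuclideanLin S y))) B y
    with hZ
  have hZpos : 0 < Z := hB.integral_weight_pos
  obtain ⟨hiso, hval⟩ := hB.lift hV
  set T := V * S * V.transpose with hT
  have hsqrt : CFC.sqrt (V * G * V.transpose) = T := sqrt_eq_of_isometry hV hG.posSemidef
  have hcomp : ∀ y, U (Matrix.toEuclideanLin V (Matrix.toEuclideanLin S
      (Matrix.toEuclideanLin V.transpose y))) = U (Matrix.toEuclideanLin T y) := fun y => by
    rw [hT, toEuclideanLin_mul_apply, toEuclideanLin_mul_apply]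
  simp only [hcomp] at hiso hval
  have hpi : 0 < 2 * Real.pi * Real.exp 1 := by positivity
  have hmin := hiso.minPartitionFn_eq (continuous_comp_toEuclideanLin hU T) (liftForm_isSymm hBs)
  rw [partitionFn_eq_ofReal hiso.1, hval] at hmin
  have hpos : 0 < (2 * Real.pi * Real.exp 1) ^ (((N : ℝ) - p) / 2) * Z :=
    mul_pos (Real.rpow_pos_of_pos hpi _) hZpos
  constructor
  · rw [hlw, lwExt, hsqrt, hmin, ENNReal.toReal_ofReal hpos.le,
      Real.log_mul (Real.rpow_pos_of_pos hpi _).ne' hZpos.ne', Real.log_rpow hpi]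
    congr 1
    ring
  · have hc1 := hiso.continuousAt_minPartitionFn hU hg (liftForm_isSymm hBs)
      (admissible_lift hV hSdet.ne' B)
    have hc2 : ContinuousWithinAt (fun G => minPartitionFn fun y =>
        U (Matrix.toEuclideanLin (CFC.sqrt G) y)) {G | G.PosSemidef} (V * G * V.transpose) := by
      refine ContinuousAt.comp_continuousWithinAt (f := CFC.sqrt)
        (g := fun T => minPartitionFn fun y => U (Matrix.toEuclideanLin T y)) ?_
        (continuousOn_sqrt N _ ?_)
      · rw [hsqrt]; exact hc1
      · rw [Set.mem_ofPred_eq, ← Matrix.conjTranspose_eq_transpose_of_trivial]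
        exact hG.posSemidef.mul_mul_conjTranspose_same V
    have hval' : (minPartitionFn fun y =>
        U (Matrix.toEuclideanLin (CFC.sqrt (V * G * V.transpose)) y)) =
        ENNReal.ofReal ((2 * Real.pi * Real.exp 1) ^ (((N : ℝ) - p) / 2) * Z) := by
      rw [hsqrt, hmin]
    have hc3 := (ENNReal.tendsto_toReal (by simp only [hval']; exact ENNReal.ofReal_ne_top)).comp hc2
    -- The limit must avoid zero for the logarithm to be continuous there.
    have hne : (minPartitionFn fun y =>
        U (Matrix.toEuclideanLin (CFC.sqrt (V * G * V.transpose)) y)).toReal ≠ 0 := by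
      rw [hval', ENNReal.toReal_ofReal hpos.le]
      exact hpos.ne'
    exact ((hc3.log hne).const_mul 2).sub_const _

/-! ### Compression to the complement of the kernel, and block matrices -/

section BasisMatrix

variable {N p : ℕ} {K : Submodule ℝ (Space N)} (v : OrthonormalBasis (Fin p) ℝ Kᗮ)

theorem toEuclideanLin_basisMatrix_apply (x : Space p) :
    Matrix.toEuclideanLin (basisMatrix v) x = ((∑ k, x k • v k : Kᗮ) : Space N) := by
  ext i
  change ∑ k, (v k : Space N) i * x k = _
  simp [mul_comm]

theorem toEuclideanLin_basisMatrix_mem (x : Space p) :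
    Matrix.toEuclideanLin (basisMatrix v) x ∈ Kᗮ := by
  rw [toEuclideanLin_basisMatrix_apply]
  exact Subtype.coe_prop _

theorem exists_toEuclideanLin_basisMatrix_eq {y : Space N} (hy : y ∈ Kᗮ) :
    ∃ x, Matrix.toEuclideanLin (basisMatrix v) x = y :=
  ⟨v.repr ⟨y, hy⟩, by rw [toEuclideanLin_basisMatrix_apply, v.sum_repr]⟩

theorem basisMatrix_transpose_mul_self : (basisMatrix v).transpose * basisMatrix v = 1 := by
  ext k l
  have h := orthonormal_iff_ite.1 v.orthonormal k l
  rw [Submodule.coe_inner, inner_eq_dotProduct] at h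
  rw [Matrix.mul_apply, Matrix.one_apply, ← h]
  rfl

theorem matrix_ext_toEuclideanLin {m n : ℕ} {A B : Matrix (Fin m) (Fin n) ℝ}
    (h : ∀ y, Matrix.toEuclideanLin A y = Matrix.toEuclideanLin B y) : A = B :=
  Matrix.toEuclideanLin.injective (LinearMap.ext h)

/-- `V Vᵀ` is the orthogonal projection onto `Kᗮ`, and `G` kills what it removes. -/
theorem mul_basisMatrix_mul_transpose {G : Matrix (Fin N) (Fin N) ℝ}
    (hK : LinearMap.ker (Matrix.toEuclideanLin G) = K) :
    G * (basisMatrix v * (basisMatrix v).transpose) = G := by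
  set V := basisMatrix v with hV
  refine matrix_ext_toEuclideanLin fun y => ?_
  have hmem : y - Matrix.toEuclideanLin (V * V.transpose) y ∈ K := by
    rw [← Submodule.orthogonal_orthogonal K]
    refine (Submodule.mem_orthogonal _ _).2 fun x hx => ?_
    obtain ⟨c, rfl⟩ := exists_toEuclideanLin_basisMatrix_eq v hx
    rw [inner_toEuclideanLin, map_sub, ← toEuclideanLin_mul_apply, ← Matrix.mul_assoc,
      basisMatrix_transpose_mul_self, Matrix.one_mul, sub_self, inner_zero_right]
  rw [← hK, LinearMap.mem_ker, map_sub, sub_eq_zero] at hmem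
  rw [toEuclideanLin_mul_apply, ← hmem]

theorem eq_conj_basisMatrix {G : Matrix (Fin N) (Fin N) ℝ} (hG : G.PosSemidef)
    (hK : LinearMap.ker (Matrix.toEuclideanLin G) = K) :
    basisMatrix v * ((basisMatrix v).transpose * G * basisMatrix v) * (basisMatrix v).transpose =
      G := by
  set V := basisMatrix v with hV
  have hGt : G.transpose = G := by
    rw [← Matrix.conjTranspose_eq_transpose_of_trivial]; exact hG.1
  have h1 : G * (V * V.transpose) = G := mul_basisMatrix_mul_transpose v hK
  have h2 : V * V.transpose * G = G := by
    have := congrArg Matrix.transpose h1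
    rwa [Matrix.transpose_mul, Matrix.transpose_mul, Matrix.transpose_transpose, hGt] at this
  calc V * (V.transpose * G * V) * V.transpose = V * V.transpose * G * (V * V.transpose) := by
        simp only [Matrix.mul_assoc]
    _ = G := by rw [h2, h1]

/-- A null vector of the compressed form is carried by `V` into both `K` and `Kᗮ`, hence to zero. -/
theorem posDef_conj_basisMatrix {G : Matrix (Fin N) (Fin N) ℝ} (hG : G.PosSemidef)
    (hK : LinearMap.ker (Matrix.toEuclideanLin G) = K) :
    ((basisMatrix v).transpose * G * basisMatrix v).PosDef := by
  set V := basisMatrix v with hV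
  have hps : (V.transpose * G * V).PosSemidef := by
    rw [← Matrix.conjTranspose_eq_transpose_of_trivial]
    exact hG.conjTranspose_mul_mul_same V
  refine Matrix.PosDef.of_dotProduct_mulVec_pos hps.1 fun x hx => ?_
  refine lt_of_le_of_ne (hps.dotProduct_mulVec_nonneg x) fun h0 => hx ?_
  have h1 : (V.transpose * G * V).mulVec x = 0 :=
    (hps.dotProduct_mulVec_zero_iff x).1 h0.symm
  set y := Matrix.toEuclideanLin V (WithLp.toLp 2 x) with hy
  have hVG : V.transpose * G * V = V.transpose * (G * V) := Matrix.mul_assoc _ _ _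
  have h2 : Matrix.toEuclideanLin G y = 0 := by
    have h3 : Matrix.toEuclideanLin (V * (V.transpose * G * V)) (WithLp.toLp 2 x) = 0 := by
      rw [toEuclideanLin_mul_apply]
      change Matrix.toEuclideanLin V (WithLp.toLp 2 ((V.transpose * G * V).mulVec x)) = 0
      rw [h1, WithLp.toLp_zero, map_zero]
    rw [hy, ← toEuclideanLin_mul_apply, ← h3]
    congr 2
    have h4 := eq_conj_basisMatrix v hG hK
    nth_rewrite 1 [← h4]
    rw [Matrix.mul_assoc _ _ (basisMatrix v), basisMatrix_transpose_mul_self, Matrix.mul_one]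
  have hyK : y ∈ K := by rw [← hK]; exact h2
  have hy0 : y = 0 := by
    rw [← inner_self_eq_zero (𝕜 := ℝ)]
    exact (Submodule.mem_orthogonal K y).1 (toEuclideanLin_basisMatrix_mem v _) y hyK
  have h5 : (WithLp.toLp 2 x : Space p) = 0 := by
    rw [← toEuclideanLin_one_apply (WithLp.toLp 2 x), ← basisMatrix_transpose_mul_self v,
      toEuclideanLin_mul_apply, ← hV, ← hy, hy0, map_zero]
  exact (WithLp.toLp_eq_zero 2).1 h5

end BasisMatrix

section PadMatrix

variable {N p : ℕ}

/-- The `N × p` matrix of the embedding `x ↦ (x, 0)`. -/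
def padInclusion (N p : ℕ) : Matrix (Fin N) (Fin p) ℝ :=
  Matrix.of fun i k => if (i : ℕ) = k then 1 else 0

theorem sum_padInclusion (f : Fin p → ℝ) (i : Fin N) :
    ∑ k, padInclusion N p i k * f k = if h : (i : ℕ) < p then f ⟨i, h⟩ else 0 := by
  simp only [padInclusion, Matrix.of_apply, ite_mul, one_mul, zero_mul]
  split_ifs with h
  · rw [Finset.sum_eq_single ⟨i, h⟩]
    · simp
    · intro b _ hb
      rw [if_neg]
      exact fun hc => hb (Fin.ext hc.symm)
    · simp
  · refine Finset.sum_eq_zero fun k _ => if_neg ?_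
    have := k.2
    omega

theorem toEuclideanLin_padInclusion (x : Space p) :
    Matrix.toEuclideanLin (padInclusion N p) x = padVector N x := by
  ext i
  exact sum_padInclusion x.ofLp i

theorem padInclusion_transpose_mul_self (hp : p ≤ N) :
    (padInclusion N p).transpose * padInclusion N p = 1 := by
  ext k l
  rw [Matrix.mul_apply, Finset.sum_eq_single ⟨k, k.2.trans_le hp⟩]
  · simp [padInclusion, Matrix.one_apply, Fin.ext_iff]
  · intro i _ hi
    have : (i : ℕ) ≠ k := fun h => hi (Fin.ext h)
    simp [padInclusion, this]
  · simp

theorem padMatrix_eq (G : Matrix (Fin p) (Fin p) ℝ) :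
    padMatrix N G = padInclusion N p * G * (padInclusion N p).transpose := by
  ext i j
  rw [Matrix.mul_assoc, Matrix.mul_apply, sum_padInclusion]
  simp only [Matrix.mul_apply, Matrix.transpose_apply, mul_comm (G _ _), sum_padInclusion,
    padMatrix, Matrix.of_apply]
  by_cases hi : (i : ℕ) < p <;> by_cases hj : (j : ℕ) < p <;> simp [hi, hj]

end PadMatrix

/-! ### Continuity, dimension zero and uniqueness -/

theorem continuous_lwExt {N : ℕ} {U : Space N → ℝ} (hU : Continuous U) (hg : StrongGrowth U) :
    Continuous fun G : {G : Matrix (Fin N) (Fin N) ℝ // G.PosSemidef} => lwExt U G := by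
  suffices hon : ContinuousOn (lwExt U) {G | G.PosSemidef} from
    continuousOn_iff_continuous_domRestrict.1 hon
  intro G hG
  -- Every positive semidefinite matrix is a conjugate `V G' Vᵀ` with `G'` positive definite, so
  -- continuity is checked stratum by stratum, against the full cone.
  set v := stdOrthonormalBasis ℝ (LinearMap.ker (Matrix.toEuclideanLin G))ᗮ
  have h := (coe_lwExt_eq_lw_and_continuousWithinAt hU hg (basisMatrix_transpose_mul_self v)
    (posDef_conj_basisMatrix v hG rfl)).2
  rwa [eq_conj_basisMatrix v hG rfl] at h

theorem lwExt_eq_lw {N : ℕ} {U : Space N → ℝ} (hU : Continuous U) (hg : StrongGrowth U)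
    {G : Matrix (Fin N) (Fin N) ℝ} (hG : G.PosDef) : (lwExt U G : EReal) = lw G U := by
  have h := (coe_lwExt_eq_lw_and_continuousWithinAt hU hg (V := 1) (by rw [Matrix.transpose_one, Matrix.one_mul])
    hG).1
  simpa only [Matrix.transpose_one, Matrix.one_mul, Matrix.mul_one, toEuclideanLin_one_apply]
    using h

/-- On a one-point space with unit mass the partition function is the single number `exp (-U 0)`. -/
theorem lw_fin_zero {U : Space 0 → ℝ} (hU : Continuous U) (hg : StrongGrowth U)
    {G : Matrix (Fin 0) (Fin 0) ℝ} (hG : G.PosDef) : lw G U = ((-2 * U 0 : ℝ) : EReal) := by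
  have hU' : (fun y => U (Matrix.toEuclideanLin 1 y)) = U := by
    simp only [toEuclideanLin_one_apply]
  obtain ⟨B, -, hB⟩ := exists_isotropic hU hg
  have h := lw_eq_of_isotropic (S := 1) hU hg hG Matrix.transpose_one (Subsingleton.elim _ _)
    (by simp) (by rw [hU']; exact hB)
  rw [h, hU', volume_euclideanSpace_eq_dirac, integral_dirac, weight, Real.log_exp]
  simp [quad]

theorem posDef_add_smul_one {N : ℕ} {G : Matrix (Fin N) (Fin N) ℝ} (hG : G.PosSemidef) {t : ℝ}
    (ht : 0 < t) : (G + t • 1).PosDef :=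
  Matrix.PosDef.posSemidef_add hG (Matrix.PosDef.one.smul ht)

theorem IsContinuousExtension.unique {N : ℕ} {U : Space N → ℝ}
    {Ψ Ψ' : {G : Matrix (Fin N) (Fin N) ℝ // G.PosSemidef} → ℝ}
    (h : IsContinuousExtension U Ψ) (h' : IsContinuousExtension U Ψ') : Ψ' = Ψ := by
  have hdense : Dense {G : {G : Matrix (Fin N) (Fin N) ℝ // G.PosSemidef} | G.1.PosDef} := by
    rintro ⟨G, hG⟩
    -- The absolute value keeps the path in the cone for all real `t`, so that it is continuous on
    -- the whole line.
    have hps : ∀ t : ℝ, (G + |t| • (1 : Matrix (Fin N) (Fin N) ℝ)).PosSemidef := fun t =>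
      hG.add (Matrix.PosSemidef.one.smul (abs_nonneg t))
    have hcont : Continuous fun t : ℝ =>
        (⟨_, hps t⟩ : {G : Matrix (Fin N) (Fin N) ℝ // G.PosSemidef}) :=
      Continuous.subtype_mk (by fun_prop) _
    have hlim := (hcont.tendsto 0).mono_left (nhdsWithin_le_nhds (s := Set.Ioi (0 : ℝ)))
    simp only [abs_zero, zero_smul, add_zero] at hlim
    refine mem_closure_of_tendsto hlim ?_
    filter_upwards [self_mem_nhdsWithin] with t ht
    exact posDef_add_smul_one hG (abs_pos.2 (ne_of_gt ht))
  refine Continuous.ext_on hdense h'.1 h.1 fun G hG => ?_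
  exact EReal.coe_injective ((h'.2 G.1 hG).trans (h.2 G.1 hG).symm)

end

end LuttingerWard

theorem theorem3p8 {N : ℕ} (U : LuttingerWard.Space N → ℝ) (hcont : Continuous U)
    (hgrowth : LuttingerWard.StrongGrowth U) :
    ∃ Ψ : {G : Matrix (Fin N) (Fin N) ℝ // G.PosSemidef} → ℝ,
      -- `Ψ` is the unique continuous extension of `Φ_N[·, U]`
      LuttingerWard.IsContinuousExtension U Ψ ∧
      (∀ Ψ' : {G : Matrix (Fin N) (Fin N) ℝ // G.PosSemidef} → ℝ,
        LuttingerWard.IsContinuousExtension U Ψ' → Ψ' = Ψ) ∧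
      -- its values on the stratum of matrices with kernel `K`
      (∀ (K : Submodule ℝ (LuttingerWard.Space N)) (p : ℕ) (v : OrthonormalBasis (Fin p) ℝ Kᗮ)
        (G : Matrix (Fin N) (Fin N) ℝ) (hG : G.PosSemidef),
        LinearMap.ker (Matrix.toEuclideanLin G) = K →
          (Ψ ⟨G, hG⟩ : EReal) =
            LuttingerWard.lw
              ((LuttingerWard.basisMatrix v).transpose * G * LuttingerWard.basisMatrix v)
              (fun x => U (Matrix.toEuclideanLin (LuttingerWard.basisMatrix v) x))) ∧
      -- its values on block matrices `diag(G, 0)`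
      (∀ p : ℕ, p ≤ N → ∀ (G : Matrix (Fin p) (Fin p) ℝ) (hG : G.PosDef),
        (Ψ ⟨LuttingerWard.padMatrix N G, LuttingerWard.padMatrix_posSemidef hG.posSemidef⟩ :
            EReal) =
          LuttingerWard.lw G (fun x => U (LuttingerWard.padVector N x))) ∧
      -- its value at the zero matrix (the case `p = 0`)
      Ψ ⟨0, Matrix.PosSemidef.zero⟩ = -2 * U 0 := by
  have hext : LuttingerWard.IsContinuousExtension U fun G => LuttingerWard.lwExt U G :=
    ⟨LuttingerWard.continuous_lwExt hcont hgrowth, fun G hG =>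
      LuttingerWard.lwExt_eq_lw hcont hgrowth hG⟩
  have hpad : ∀ p : ℕ, p ≤ N → ∀ G : Matrix (Fin p) (Fin p) ℝ, G.PosDef →
      (LuttingerWard.lwExt U (LuttingerWard.padMatrix N G) : EReal) =
        LuttingerWard.lw G (fun x => U (LuttingerWard.padVector N x)) := fun p hp G hG => by
    have h := (LuttingerWard.coe_lwExt_eq_lw_and_continuousWithinAt hcont hgrowth
      (LuttingerWard.padInclusion_transpose_mul_self hp) hG).1
    simpa only [← LuttingerWard.padMatrix_eq, LuttingerWard.toEuclideanLin_padInclusion] using h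
  refine ⟨fun G => LuttingerWard.lwExt U G, hext, fun Ψ' hΨ' => hext.unique hΨ',
    fun K p v G hG hK => ?_, fun p hp G hG => hpad p hp G hG, ?_⟩
  · have h := (LuttingerWard.coe_lwExt_eq_lw_and_continuousWithinAt hcont hgrowth
      (LuttingerWard.basisMatrix_transpose_mul_self v)
      (LuttingerWard.posDef_conj_basisMatrix v hG hK)).1
    rwa [LuttingerWard.eq_conj_basisMatrix v hG hK] at h
  -- The empty matrix is positive definite, so the zero matrix is the block case with `p = 0`.
  · have h1 : (1 : Matrix (Fin 0) (Fin 0) ℝ).PosDef := Matrix.PosDef.one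
    have h := hpad 0 (Nat.zero_le N) 1 h1
    have hV := LuttingerWard.padInclusion_transpose_mul_self (Nat.zero_le N)
    have hz : (LuttingerWard.padMatrix N (1 : Matrix (Fin 0) (Fin 0) ℝ)) = 0 := by
      ext i j
      simp [LuttingerWard.padMatrix]
    have hv : LuttingerWard.padVector N (0 : LuttingerWard.Space 0) = 0 := by
      rw [← LuttingerWard.toEuclideanLin_padInclusion, map_zero]
    simp only [← LuttingerWard.toEuclideanLin_padInclusion] at h hv
    rw [hz, LuttingerWard.lw_fin_zero
      (LuttingerWard.continuous_comp_toEuclideanLin hcont _) (hgrowth.comp_isometry hV) h1, hv] at h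
    exact EReal.coe_injective h
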